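/- **Setting.** Let $\mathcal G=(V,E)$ be a finite graph without loops, regarded as a directed graph with $(i,j)\in E\Rightarrow (j,i)\in E$, and let $m=|E|$ be the number of directed edges. Let $d\ge 2$, let $\mathcal X\subset\mathbb R^d$ be a finite arm set, $\mathbf M_\star\in\mathbb R^{d\times d}$ an unknown matrix, $z_{xx'}=\mathrm{vec}(xx'^{\top})\in\mathbb R^{d^2}$ the edge-arms and $\theta_\star=\mathrm{vec}(\mathbf M_\star)$, so that $\langle z_{xx'},\theta_\star\rangle=x^\top\mathbf M_\star x'$. Assume $\|z_{xx'}\|_2\le L$ and $x^\top\mathbf M_\star x'\ge 0$ for all $x,x'\in\mathcal X$, and $\|\mathbf M_\star\|_F\le S$ (hence $0\le x^\top \mathbf M_\star x'\le LS$). In each round $t$ a joint arm $(x_t^{(i)})_{i\in V}\in\mathcal X^V$ is played and the rewards $y_t^{(i,j)}=x_t^{(i)\top}\mathbf M_\star x_t^{(j)}+\eta_t^{(i,j)}$, $(i,j)\in E$, are observed; put $z_t^{(i,j)}=z_{x_t^{(i)}x_t^{(j)}}$. With respect to a filtration $(\mathcal F_t)_{t\ge 0}$, the noise $\eta_t=(\eta_t^{(i,j)})_{(i,j)\in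 E}$ is $\mathcal F_t$-measurable and, given $\mathcal F_{t-1}$, centred and $\sigma$-sub-Gaussian ($\sigma\ge0$) in the sense that $\mathbb E[\exp(\sum_{e\in E} c_e\eta_t^{e})\mid\mathcal F_{t-1}]\le\exp(\frac{\sigma^2}{2}\sum_{e\in E} c_e^2)$ a.s. for all $c\in\mathbb R^E$, the left-hand exponential being integrable (for example, all $\eta_t^{(i,j)}$ are independent, centred and $\sigma$-sub-Gaussian). Let $(x_\star^{(i)})_{i\in V}\in\mathcal X^V$ maximize $\sum_{(i,j)\in E}x^{(i)\top}\mathbf M_\star x^{(j)}$, and let $\mathrm{OPT}$ be the maximum; assume $\mathrm{OPT}>0$. Let $$R_\alpha(T)=\sum_{t=1}^T\Big[\alpha\,\mathrm{OPT}-\sum_{(i,j)\in E}x_t^{(i)\top}\mathbf M_\star x_t^{(j)}\Big].$$ **Algorithm.** Let $(V_1,V_2)$ be a partition of $V$ (a cut). Let $m_{1\to2},m_{2\to1},m_1,m_2$ be the numbers of edges in $E$ from $V_1$ to $V_2$, from $V_2$ to $V_1$, inside $V_1$, and inside $V_2$, and put $$Z(x,x')=m_{1\to2}z_{xx'}+m_{2\to1}z_{x'x}+m_1z_{xx}+m_2z_{x'x'}.$$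 For $\lambda>0$ and $\delta\in(0,1]$ let $\mathbf A_t=\lambda I+\sum_{s\le t}\sum_{e\in E}z_s^{e}z_s^{e\top}$, $\hat\theta_t=\mathbf A_t^{-1}\sum_{s\le t}\sum_{e\in E}y_s^{e}z_s^{e}$ and $$C_t=\Big\{\theta:\|\theta-\hat\theta_t\|_{\mathbf A_t}\le\sigma\sqrt{d^2\log\tfrac{1+tmL^2/\lambda}{\delta}}+\sqrt\lambda S\Big\},\qquad \|v\|_{\mathbf A}=\sqrt{v^\top\mathbf Av}.$$ In rounds $t=1,\dots,T$ the algorithm chooses, as a function of the past (i.e. $\mathcal F_{t-1}$-measurably), $(x_t,x_t',\tilde\theta_{t-1})\in\operatorname{argmax}_{(x,x',\theta)\in\mathcal X^2\times C_{t-1}}\langle Z(x,x'),\theta\rangle$, ties being broken arbitrarily. All nodes of $V_1$ play $x_t$ and all nodes of $V_2$ play $x_t'$. **Parameters.** Let $$\gamma=\min_{x\in\mathcal X}\frac{\langle z_{xx},\theta_\star\rangle}{\frac1m\mathrm{OPT}}.$$ Let $(x_\star,x_\star')\in\mathcal X^2$ maximize $\langle z_{xx'}+z_{x'x},\theta_\star\rangle$,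 let $(\tilde x_\star,\tilde x_\star')\in\mathcal X^2$ maximize $\langle Z(x,x'),\theta_\star\rangle$ (any maximizers), and let $$\Delta=\langle Z(\tilde x_\star,\tilde x'_\star)-Z(x_\star,x_\star'),\theta_\star\rangle,\qquad \epsilon=\frac{\Delta}{\mathrm{OPT}},\qquad \alpha=1-\Big[\frac{m_1+m_2}{m}(1-\gamma)-\epsilon\Big].$$ **Theorem 4.1.** One has $0\le\gamma\le1$, $\Delta\ge0$, $\epsilon\ge0$, $\alpha\le1$, and with probability at least $1-\delta$ $$R_\alpha(T)\le\sqrt{32\,Tm\,d^2\max(2,(LS)^2)\log\Big(1+\frac{TmL^2/\lambda}{d^2}\Big)}\left(\sigma\sqrt{d^2\log\frac{1+TmL^2/\lambda}{\delta}}+\sqrt\lambda S\right)+LSm\left\lceil d^2\log_2\Big(\frac{TmL^2/\lambda}{\delta}\Big)\right\rceil^+,$$ where $\lceil a\rceil^+=\max(\lceil a\rceil,0)$ (for $T=0$ the last term is $0$). Up to logarithmic factors, the first term is $(\sigma d^2+dS\sqrt\lambda)\sqrt{Tm\max(2,(LS)^2)}$. Moreover: * if the cut contains at least half of the edges, i.e.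 $m_{1\to2}+m_{2\to1}\ge m/2$, then $\epsilon\le\frac12$ and $\alpha\ge\frac12$; * this is the case if $(V_1,V_2)$ is the output of the greedy algorithm Approx-MAX-CUT, which runs through the nodes in any order and puts node $i$ into $V_2$ if $i$ has strictly more neighbours in the current $V_1$ than in the current $V_2$, and into $V_1$ otherwise; * if the graph is bipartite with parts $V_1,V_2$ (every edge joins $V_1$ and $V_2$), then $\epsilon=0$ and $\alpha=1$, so that the bound holds for the regret $R_1(T)$ itself. -/

import Mathlib

open MeasureTheory Matrix

namespace GraphicalBilinear

noncomputable section

/-! ### The graph and its cuts -/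

/-- The directed edge set `E` of the graph: all ordered pairs of neighbours, so that `(i, j) ∈ E`
implies `(j, i) ∈ E`. Its cardinality is `m`. -/
def edges {V : Type*} [Fintype V] (G : SimpleGraph V) [DecidableRel G.Adj] : Finset (V × V) :=
  Finset.univ.filter fun e => G.Adj e.1 e.2

/-- The number of directed edges that go from `U` to `W`. For a cut `(V₁, V₂)` this gives
`m_{1→2}`, `m_{2→1}`, `m₁ = edgesFromTo G V₁ V₁` and `m₂ = edgesFromTo G V₂ V₂`. -/
def edgesFromTo {V : Type*} [Fintype V] [DecidableEq V] (G : SimpleGraph V) [DecidableRel G.Adj]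
    (U W : Finset V) : ℕ :=
  ((edges G).filter fun e => e.1 ∈ U ∧ e.2 ∈ W).card

/-- One step of the greedy cut: node `i` joins `V₂` if it has strictly more neighbours in `V₁`
than in `V₂`, and joins `V₁` otherwise. -/
def approxMaxCutStep {V : Type*} [DecidableEq V] (G : SimpleGraph V) [DecidableRel G.Adj]
    (c : Finset V × Finset V) (i : V) : Finset V × Finset V :=
  if (c.2.filter fun j => G.Adj i j).card < (c.1.filter fun j => G.Adj i j).card
  then (c.1, insert i c.2) else (insert i c.1, c.2)

/-- The greedy algorithm Approx-MAX-CUT, processing the nodes in the order of the list `l`. -/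
def approxMaxCut {V : Type*} [DecidableEq V] (G : SimpleGraph V) [DecidableRel G.Adj]
    (l : List V) : Finset V × Finset V :=
  l.foldl (approxMaxCutStep G) (∅, ∅)

/-! ### Arms and rewards -/

/-- The edge-arm `z_{x x'} = vec(x x'ᵀ)` (columns concatenated), a vector with `d²` coordinates. -/
def edgeArm {d : ℕ} (x x' : Fin d → ℝ) : Fin d × Fin d → ℝ :=
  vec (vecMulVec x x')

/-- The expected bilinear reward `xᵀ M x'` of an edge. -/
def edgeReward {d : ℕ} (M : Matrix (Fin d) (Fin d) ℝ) (x x' : Fin d → ℝ) : ℝ :=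
  x ⬝ᵥ (M *ᵥ x')

/-- The linear form of the reward: `xᵀ M x' = ⟨z_{x x'}, vec M⟩`. -/
theorem edgeArm_dotProduct_vec {d : ℕ} (M : Matrix (Fin d) (Fin d) ℝ) (x x' : Fin d → ℝ) :
    edgeArm x x' ⬝ᵥ vec M = edgeReward M x x' := by
  simp only [edgeArm, edgeReward, dotProduct, mulVec, vec, vecMulVec_apply, Fintype.sum_prod_type,
    Finset.mul_sum]
  rw [Finset.sum_comm]
  exact Finset.sum_congr rfl fun i _ => Finset.sum_congr rfl fun j _ => by ring

/-- The expected global reward `∑_{(i,j) ∈ E} x⁽ⁱ⁾ᵀ M x⁽ʲ⁾` of a joint arm. -/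
def globalReward {V : Type*} [Fintype V] (G : SimpleGraph V) [DecidableRel G.Adj] {d : ℕ}
    (M : Matrix (Fin d) (Fin d) ℝ) (x : V → Fin d → ℝ) : ℝ :=
  ∑ e ∈ edges G, edgeReward M (x e.1) (x e.2)

/-- The joint arm that gives `x` to the nodes of `V₁` and `x'` to the other nodes. -/
def allocate {V : Type*} [DecidableEq V] {d : ℕ} (V₁ : Finset V) (x x' : Fin d → ℝ) :
    V → Fin d → ℝ :=
  fun i => if i ∈ V₁ then x else x'

/-- `m_{1→2} z_{x x'} + m_{2→1} z_{x' x} + m₁ z_{x x} + m₂ z_{x' x'}`. -/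
def cutArm {V : Type*} [Fintype V] [DecidableEq V] (G : SimpleGraph V) [DecidableRel G.Adj]
    {d : ℕ} (V₁ V₂ : Finset V) (x x' : Fin d → ℝ) : Fin d × Fin d → ℝ :=
  (edgesFromTo G V₁ V₂ : ℝ) • edgeArm x x' + (edgesFromTo G V₂ V₁ : ℝ) • edgeArm x' x
    + (edgesFromTo G V₁ V₁ : ℝ) • edgeArm x x + (edgesFromTo G V₂ V₂ : ℝ) • edgeArm x' x'

/-- The `α`-pseudo-regret over the rounds `0, …, T - 1`, for an optimal joint arm `xopt` and the
joint arms `a t` that were played. -/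
def alphaRegret {V : Type*} [Fintype V] (G : SimpleGraph V) [DecidableRel G.Adj] {d : ℕ}
    (M : Matrix (Fin d) (Fin d) ℝ) (α : ℝ) (xopt : V → Fin d → ℝ) (a : ℕ → V → Fin d → ℝ)
    (T : ℕ) : ℝ :=
  ∑ t ∈ Finset.range T, (α * globalReward G M xopt - globalReward G M (a t))

/-! ### Regularized least squares and confidence sets

Rounds are numbered from `0`, so an index `t` means "after the `t` rounds `0, …, t - 1`". Below,
`a s` is the joint arm played in round `s` and `y s (i, j)` the reward observed on the edge
`(i, j)` in that round. -/

/-- `A_t = λ I + ∑_{s < t} ∑_{(i,j) ∈ E} z_s z_sᵀ`. -/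
def designMatrix {V : Type*} [Fintype V] (G : SimpleGraph V) [DecidableRel G.Adj] {d : ℕ}
    (lam : ℝ) (a : ℕ → V → Fin d → ℝ) (t : ℕ) : Matrix (Fin d × Fin d) (Fin d × Fin d) ℝ :=
  lam • (1 : Matrix (Fin d × Fin d) (Fin d × Fin d) ℝ) + ∑ s ∈ Finset.range t, ∑ e ∈ edges G,
    vecMulVec (edgeArm (a s e.1) (a s e.2)) (edgeArm (a s e.1) (a s e.2))

/-- The estimator `A_t⁻¹ b_t`, where `b_t = ∑_{s < t} ∑_{(i,j) ∈ E} y_s z_s`. -/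
def estimator {V : Type*} [Fintype V] (G : SimpleGraph V) [DecidableRel G.Adj] {d : ℕ}
    (lam : ℝ) (a : ℕ → V → Fin d → ℝ) (y : ℕ → V × V → ℝ) (t : ℕ) : Fin d × Fin d → ℝ :=
  (designMatrix G lam a t)⁻¹ *ᵥ
    ∑ s ∈ Finset.range t, ∑ e ∈ edges G, y s e • edgeArm (a s e.1) (a s e.2)

/-- `‖v‖_A = √(vᵀ A v)`. -/
def weightedNorm {ι : Type*} [Fintype ι] (A : Matrix ι ι ℝ) (v : ι → ℝ) : ℝ :=
  √(v ⬝ᵥ (A *ᵥ v))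

/-- `σ √(d² log((1 + t m L² / λ) / δ)) + √λ S`. -/
def confidenceRadius (d m : ℕ) (σ lam L S δ : ℝ) (t : ℕ) : ℝ :=
  σ * √((d : ℝ) ^ 2 * Real.log ((1 + t * m * L ^ 2 / lam) / δ)) + √lam * S

/-- The confidence ellipsoid `C_t(δ)` around the estimator. -/
def confidenceSet {V : Type*} [Fintype V] (G : SimpleGraph V) [DecidableRel G.Adj] {d : ℕ}
    (σ lam L S δ : ℝ) (a : ℕ → V → Fin d → ℝ) (y : ℕ → V × V → ℝ) (t : ℕ) :
    Set (Fin d × Fin d → ℝ) :=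
  {θ | weightedNorm (designMatrix G lam a t) (θ - estimator G lam a y t)
        ≤ confidenceRadius d (edges G).card σ lam L S δ t}

/-! ### The noise and the algorithm -/

/-- The noise is conditionally centred and `σ`-sub-Gaussian: the noise of round `t` is known after
that round, and, given the past `ℱ t`, its linear combinations over the edges obey the sub-Gaussian
bound that independent centred `σ`-sub-Gaussian variables obey. -/
structure IsSubGaussianNoise {V Ω : Type*} [Fintype V] (G : SimpleGraph V) [DecidableRel G.Adj]
    {mΩ : MeasurableSpace Ω} (μ : Measure Ω) (ℱ : Filtration ℕ mΩ) (σ : ℝ)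
    (η : ℕ → V × V → Ω → ℝ) : Prop where
  measurable : ∀ t, ∀ e ∈ edges G, Measurable[ℱ (t + 1)] (η t e)
  integrable : ∀ t (c : V × V → ℝ),
    Integrable (fun ω => Real.exp (∑ e ∈ edges G, c e * η t e ω)) μ
  condExp_le : ∀ t (c : V × V → ℝ),
    μ[fun ω => Real.exp (∑ e ∈ edges G, c e * η t e ω) | ℱ t]
      ≤ᵐ[μ] fun _ => Real.exp (σ ^ 2 * (∑ e ∈ edges G, c e ^ 2) / 2)

/-- The rewards `y_t^{(i,j)} = x_t^{(i)ᵀ} M x_t^{(j)} + η_t^{(i,j)}`. -/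
def observedReward {V Ω : Type*} {d : ℕ} (M : Matrix (Fin d) (Fin d) ℝ)
    (η : ℕ → V × V → Ω → ℝ) (a : ℕ → V → Fin d → ℝ) (ω : Ω) : ℕ → V × V → ℝ :=
  fun s e => edgeReward M (a s e.1) (a s e.2) + η s e ω

/-- `(x t, x' t)`, `t < T`, are the pairs chosen in a run of the improved OFUL algorithm with the
cut `(V₁, V₂)`: in each round the pair is a function of the past and is, together with some `θ` in
the current confidence set, a maximizer of `⟨m_{1→2} z_{y y'} + m_{2→1} z_{y' y} + m₁ z_{y y} +
m₂ z_{y' y'}, θ'⟩` over all pairs of arms `y, y'` and all `θ'` in the confidence set. The nodes of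
`V₁` then play `x t` and those of `V₂` play `x' t`. Ties are broken arbitrarily. -/
structure IsImprovedOFULRun {V Ω : Type*} [Fintype V] [DecidableEq V] (G : SimpleGraph V)
    [DecidableRel G.Adj] {mΩ : MeasurableSpace Ω} (ℱ : Filtration ℕ mΩ) {d : ℕ}
    (X : Finset (Fin d → ℝ)) (M : Matrix (Fin d) (Fin d) ℝ) (η : ℕ → V × V → Ω → ℝ)
    (V₁ V₂ : Finset V) (σ lam L S δ : ℝ) (T : ℕ) (x x' : ℕ → Ω → Fin d → ℝ) : Prop where
  measurable_fst : ∀ t < T, Measurable[ℱ t] (x t)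
  measurable_snd : ∀ t < T, Measurable[ℱ t] (x' t)
  mem_fst : ∀ t < T, ∀ ω, x t ω ∈ X
  mem_snd : ∀ t < T, ∀ ω, x' t ω ∈ X
  optimistic : ∀ t < T, ∀ ω,
    let a : ℕ → V → Fin d → ℝ := fun s => allocate V₁ (x s ω) (x' s ω)
    let C : Set (Fin d × Fin d → ℝ) :=
      confidenceSet G σ lam L S δ a (observedReward M η a ω) t
    ∃ θ ∈ C, ∀ y ∈ X, ∀ y' ∈ X, ∀ θ' ∈ C,
      cutArm G V₁ V₂ y y' ⬝ᵥ θ' ≤ cutArm G V₁ V₂ (x t ω) (x' t ω) ⬝ᵥ θ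

/-- The regret bound
`√(32 T m d² max(2, (LS)²) log(1 + T m L² / (λ d²))) (σ √(d² log((1 + T m L² / λ) / δ)) + √λ S)`
`+ L S m ⌈d² log₂((T m L² / λ) / δ)⌉`, where a negative last factor counts as `0`. -/
def regretBound (d m T : ℕ) (σ lam L S δ : ℝ) : ℝ :=
  √(32 * T * m * (d : ℝ) ^ 2 * max 2 ((L * S) ^ 2)
      * Real.log (1 + T * m * L ^ 2 / lam / (d : ℝ) ^ 2))
    * (σ * √((d : ℝ) ^ 2 * Real.log ((1 + T * m * L ^ 2 / lam) / δ)) + √lam * S)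
  + L * S * m * (⌈(d : ℝ) ^ 2 * Real.logb 2 (T * m * L ^ 2 / lam / δ)⌉₊ : ℝ)

end

end GraphicalBilinear

/-! The argument separates a combinatorial comparison from the analysis of optimistic linear
bandits.

Comparison. Adding each edge to its reverse shows that the best pair `(xs, xs')` earns at least `2 *
OPT / m` on an edge together with its reverse. If the cut plays this pair, the cut edges earn at
least their share of `OPT` and every inner edge earns at least `γ * OPT / m`. The cut-optimal pair
gains a further `Δ = ε * OPT`, so its value is at least `α * OPT`. It therefore suffices to bound
the regret against the best allocation along the cut. That allocation is feasible, so its value is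
at most `OPT`, which bounds `ε` from above and gives `α ≤ 1`.

Confidence. Integrating exponential supermartingales against an unnormalised Gaussian weight gives a
supermartingale with an explicit value. Ville's inequality then controls the noise in the norm of
the inverse design matrix, uniformly in time (`IsSubGaussianNoise.measure_exists_le_mixture`), so
`vec M` lies in all confidence sets outside an event of mass at most `δ`.

Regret. On the good event, optimism and Cauchy–Schwarz bound the regret of round `t` by `2 * R * √(m
* w t)`, where `R` is the final radius and `w t` sums the squared inverse-design norms of the
edge-arms of the round. The determinant of the design matrix grows at least by the factor `1 + w t`,
while its trace bounds it from above. Since the matrix is updated only once per round, `w t` may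
exceed `1`. Such rounds are charged `L * S * m` each, and they are few because each at least doubles
the product. The remaining rounds satisfy `w t ≤ 2 * log (1 + w t)` and give the square-root term
(`sum_regret_le_regretBound`). -/

namespace GraphicalBilinear

/-! ### Weighted norms, determinants and Gaussian integrals -/

section LinearAlgebra

variable {ι : Type*} [Fintype ι]

-- The factor `B` turns the norm weighted by `A` into the Euclidean norm of `B *ᵥ v`, and its
-- inverse transpose does the same for `A⁻¹`.
open scoped MatrixOrder in
theorem exists_eq_transpose_mul_self [DecidableEq ι] {A : Matrix ι ι ℝ} (hA : A.PosDef) :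
    ∃ B : Matrix ι ι ℝ, A = Bᵀ * B ∧ B.det ≠ 0 := by
  obtain ⟨B, hB⟩ := CStarAlgebra.nonneg_iff_eq_star_mul_self.mp hA.posSemidef.nonneg
  have hB' : A = Bᵀ * B := by rw [hB, star_eq_conjTranspose, conjTranspose_eq_transpose_of_trivial]
  refine ⟨B, hB', fun h => hA.det_pos.ne' ?_⟩
  rw [hB', det_mul, h, mul_zero]

theorem dotProduct_transpose_mul_self_mulVec (B : Matrix ι ι ℝ) (u v : ι → ℝ) :
    u ⬝ᵥ ((Bᵀ * B) *ᵥ v) = (B *ᵥ u) ⬝ᵥ (B *ᵥ v) := by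
  rw [← mulVec_mulVec, dotProduct_mulVec, vecMul_transpose]

theorem dotProduct_sq_le (u v : ι → ℝ) : (u ⬝ᵥ v) ^ 2 ≤ (u ⬝ᵥ u) * (v ⬝ᵥ v) := by
  simpa [dotProduct, sq] using Finset.sum_mul_sq_le_sq_mul_sq Finset.univ u v

theorem dotProduct_inv_mulVec [DecidableEq ι] {A B : Matrix ι ι ℝ} (hA : A = Bᵀ * B)
    (z : ι → ℝ) : z ⬝ᵥ (A⁻¹ *ᵥ z) = (Bᵀ⁻¹ *ᵥ z) ⬝ᵥ (Bᵀ⁻¹ *ᵥ z) := by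
  rw [hA, Matrix.mul_inv_rev, ← mulVec_mulVec, dotProduct_mulVec, ← transpose_nonsing_inv,
    ← mulVec_transpose]

theorem abs_dotProduct_le_weightedNorm_mul [DecidableEq ι] {A : Matrix ι ι ℝ} (hA : A.PosDef) (z v : ι → ℝ) :
    |z ⬝ᵥ v| ≤ weightedNorm A⁻¹ z * weightedNorm A v := by
  obtain ⟨B, hAB, hB⟩ := exists_eq_transpose_mul_self hA
  have hz : z ⬝ᵥ v = (Bᵀ⁻¹ *ᵥ z) ⬝ᵥ (B *ᵥ v) := by
    rw [← vecMul_transpose, ← dotProduct_mulVec, mulVec_mulVec, transpose_nonsing_inv,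
      transpose_transpose, Matrix.nonsing_inv_mul _ hB.isUnit, one_mulVec]
  have h0 : 0 ≤ z ⬝ᵥ (A⁻¹ *ᵥ z) := by
    rw [dotProduct_inv_mulVec hAB]
    exact Finset.sum_nonneg fun i _ => mul_self_nonneg _
  rw [weightedNorm, weightedNorm, ← Real.sqrt_mul h0]
  apply Real.abs_le_sqrt
  rw [hz, dotProduct_inv_mulVec hAB]
  conv_rhs => rw [hAB, dotProduct_transpose_mul_self_mulVec]
  exact dotProduct_sq_le _ _

theorem weightedNorm_add_le [DecidableEq ι] {A : Matrix ι ι ℝ} (hA : A.PosDef) (u v : ι → ℝ) :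
    weightedNorm A (u + v) ≤ weightedNorm A u + weightedNorm A v := by
  obtain ⟨B, hAB, hB⟩ := exists_eq_transpose_mul_self hA
  have h (w : ι → ℝ) : weightedNorm A w = ‖WithLp.toLp 2 (B *ᵥ w)‖ := by
    rw [weightedNorm, hAB, dotProduct_transpose_mul_self_mulVec, EuclideanSpace.norm_eq]
    simp [dotProduct, sq]
  rw [h, h, h, mulVec_add, WithLp.toLp_add]
  exact norm_add_le _ _

theorem one_add_sum_le_prod_one_add {κ : Type*} (s : Finset κ) (f : κ → ℝ)
    (hf : ∀ i ∈ s, 0 ≤ f i) : 1 + ∑ i ∈ s, f i ≤ ∏ i ∈ s, (1 + f i) := by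
  classical
  induction s using Finset.induction_on with
  | empty => simp
  | insert a s ha ih =>
    rw [Finset.sum_insert ha, Finset.prod_insert ha]
    have h1 := hf a (Finset.mem_insert_self a s)
    have h2 := ih fun i hi => hf i (Finset.mem_insert_of_mem hi)
    have h3 : 0 ≤ ∑ i ∈ s, f i := Finset.sum_nonneg fun i hi => hf i (Finset.mem_insert_of_mem hi)
    nlinarith

/-- The determinant is the product of `1 + λᵢ` over the nonnegative eigenvalues; expanding it and
keeping the constant and linear terms leaves one plus the trace. -/
theorem one_add_trace_le_det_one_add [DecidableEq ι] {K : Matrix ι ι ℝ} (hK : K.PosSemidef) :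
    1 + K.trace ≤ (1 + K).det := by
  have hdet : (1 + K).det = ∏ i, (1 + hK.1.eigenvalues i) := by
    -- The characteristic polynomial at `-1` is `det (-(1 + K))`; the sign on both sides is
    -- cancelled below.
    have h := congrArg (Polynomial.eval (-1)) hK.1.charpoly_eq
    rw [Matrix.eval_charpoly, Polynomial.eval_prod] at h
    have h2 : (Matrix.scalar ι (-1 : ℝ) - K) = -(1 + K) := by
      rw [map_neg, map_one]; abel
    rw [h2, det_neg] at h
    simp only [Polynomial.eval_sub, Polynomial.eval_X, Polynomial.eval_C] at h
    have h3 : ∏ i, (-1 - (hK.1.eigenvalues i : ℝ)) = (-1) ^ Fintype.card ι * ∏ i, (1 + hK.1.eigenvalues i) := by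
      rw [← Finset.card_univ, ← Finset.prod_const, ← Finset.prod_mul_distrib]
      exact Finset.prod_congr rfl fun i _ => by ring
    exact mul_left_cancel₀ (pow_ne_zero _ (by norm_num)) (h.trans h3)
  rw [hdet, hK.1.trace_eq_sum_eigenvalues]
  exact one_add_sum_le_prod_one_add _ _ fun i _ => hK.eigenvalues_nonneg i

theorem posSemidef_sum_vecMulVec_self {κ : Type*} (s : Finset κ) (z : κ → ι → ℝ) :
    (∑ e ∈ s, vecMulVec (z e) (z e)).PosSemidef :=
  posSemidef_sum s fun e _ => by simpa using posSemidef_vecMulVec_self_star (z e)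

/-- A substitute for the rank-one determinant identity when all edge-arms of a round are added at
once: factoring out `B` leaves `1 + K`, where the trace of `K` is the sum of the squared inverse
norms. -/
theorem det_mul_one_add_sum_le [DecidableEq ι] {A : Matrix ι ι ℝ} (hA : A.PosDef) {κ : Type*} (s : Finset κ)
    (z : κ → ι → ℝ) :
    A.det * (1 + ∑ e ∈ s, z e ⬝ᵥ (A⁻¹ *ᵥ z e)) ≤ (A + ∑ e ∈ s, vecMulVec (z e) (z e)).det := by
  obtain ⟨B, hAB, hB⟩ := exists_eq_transpose_mul_self hA
  set w : κ → ι → ℝ := fun e => Bᵀ⁻¹ *ᵥ z e with hw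
  set K := ∑ e ∈ s, vecMulVec (w e) (w e) with hK
  have hBt : IsUnit Bᵀ.det := by rw [det_transpose]; exact hB.isUnit
  have hz (e : κ) : z e = Bᵀ *ᵥ w e := by
    rw [hw, mulVec_mulVec, Matrix.mul_nonsing_inv _ hBt, one_mulVec]
  have h1 : A + ∑ e ∈ s, vecMulVec (z e) (z e) = Bᵀ * (1 + K) * B := by
    rw [mul_add, add_mul, mul_one, ← hAB, hK, Finset.mul_sum, Finset.sum_mul]
    congr 1
    refine Finset.sum_congr rfl fun e _ => ?_
    rw [mul_vecMulVec, vecMulVec_mul, ← hz, ← mulVec_transpose, ← hz]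
  have h2 : ∑ e ∈ s, z e ⬝ᵥ (A⁻¹ *ᵥ z e) = K.trace := by
    rw [hK, trace_sum]
    refine Finset.sum_congr rfl fun e _ => ?_
    rw [trace_vecMulVec, dotProduct_inv_mulVec hAB]
  have h3 : A.det = B.det * B.det := by rw [hAB, det_mul, det_transpose]
  rw [h1, h2, det_mul, det_mul, det_transpose, h3]
  have := one_add_trace_le_det_one_add (posSemidef_sum_vecMulVec_self s w)
  nlinarith [mul_le_mul_of_nonneg_left this (mul_self_nonneg B.det)]

/-- The arithmetic–geometric mean inequality for the eigenvalues. -/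
theorem det_le_trace_div_card_pow [DecidableEq ι] [Nonempty ι] {A : Matrix ι ι ℝ} (hA : A.PosSemidef) :
    A.det ≤ (A.trace / Fintype.card ι) ^ Fintype.card ι := by
  have hc : (0 : ℝ) < Fintype.card ι := by exact_mod_cast Fintype.card_pos
  have h := Real.geom_mean_le_arith_mean Finset.univ (fun _ : ι => (1 : ℝ)) hA.1.eigenvalues
    (fun _ _ => zero_le_one) (by simpa using hc) fun i _ => hA.eigenvalues_nonneg i
  have hp : 0 ≤ ∏ i, hA.1.eigenvalues i := Finset.prod_nonneg fun i _ => hA.eigenvalues_nonneg i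
  simp only [Real.rpow_one, one_mul, Finset.sum_const, Finset.card_univ, nsmul_eq_mul,
    mul_one] at h
  have h2 := pow_le_pow_left₀ (Real.rpow_nonneg hp _) h (Fintype.card ι)
  rw [Real.rpow_inv_natCast_pow hp Fintype.card_ne_zero] at h2
  rw [hA.1.det_eq_prod_eigenvalues, hA.1.trace_eq_sum_eigenvalues]
  exact h2

/-- Complete the square around `A⁻¹ *ᵥ s`, translate, and substitute `v = B *ᵥ u`, whose Jacobian is
`√A.det`. The standard Gaussian integral stays unevaluated: it cancels later, so only its being
nonzero and finite matters. -/
theorem lintegral_exp_linear_sub_quadratic [DecidableEq ι] {A : Matrix ι ι ℝ} (hA : A.PosDef)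
    (s : ι → ℝ) :
    ∫⁻ u : ι → ℝ, ENNReal.ofReal (Real.exp (u ⬝ᵥ s - u ⬝ᵥ (A *ᵥ u) / 2))
      = ENNReal.ofReal (Real.exp (s ⬝ᵥ (A⁻¹ *ᵥ s) / 2) / √A.det)
        * ∫⁻ v : ι → ℝ, ENNReal.ofReal (Real.exp (-(v ⬝ᵥ v) / 2)) := by
  obtain ⟨B, hAB, hB⟩ := exists_eq_transpose_mul_self hA
  have hAu : IsUnit A.det := hA.det_pos.ne'.isUnit
  have hAt : Aᵀ = A := by rw [hAB, transpose_mul, transpose_transpose]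
  have hsq (u : ι → ℝ) : u ⬝ᵥ s - u ⬝ᵥ (A *ᵥ u) / 2 = s ⬝ᵥ (A⁻¹ *ᵥ s) / 2
      + -((B *ᵥ (u - A⁻¹ *ᵥ s)) ⬝ᵥ (B *ᵥ (u - A⁻¹ *ᵥ s))) / 2 := by
    rw [← dotProduct_transpose_mul_self_mulVec, ← hAB, mulVec_sub, mulVec_mulVec,
      Matrix.mul_nonsing_inv _ hAu, one_mulVec, dotProduct_sub, sub_dotProduct, sub_dotProduct,
      dotProduct_comm (A⁻¹ *ᵥ s) s, dotProduct_mulVec (A⁻¹ *ᵥ s), ← mulVec_transpose, hAt,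
      mulVec_mulVec, Matrix.mul_nonsing_inv _ hAu, one_mulVec, dotProduct_comm s u]
    ring
  have hdet : √A.det = |B.det| := by
    rw [hAB, det_mul, det_transpose, Real.sqrt_mul_self_eq_abs]
  have hcont : Measurable fun v : ι → ℝ => ENNReal.ofReal (Real.exp (-(v ⬝ᵥ v) / 2)) := by
    unfold dotProduct; fun_prop
  have hmul : Measurable fun v : ι → ℝ => toLin' B v :=
    ((toLin' B).continuous_on_pi).measurable
  simp_rw [hsq, Real.exp_add, ENNReal.ofReal_mul (Real.exp_nonneg _)]
  rw [lintegral_const_mul' _ _ ENNReal.ofReal_ne_top,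
    lintegral_sub_right_eq_self
      (fun u => ENNReal.ofReal (Real.exp (-((B *ᵥ u) ⬝ᵥ (B *ᵥ u)) / 2))) (A⁻¹ *ᵥ s),
    div_eq_mul_inv (Real.exp _), ENNReal.ofReal_mul (Real.exp_nonneg _), mul_assoc]
  congr 1
  have h := lintegral_map (μ := volume) hcont hmul
  rw [Real.map_matrix_volume_pi_eq_smul_volume_pi hB, lintegral_smul_measure] at h
  rw [hdet, ← abs_inv]
  exact h.symm

theorem lintegral_exp_neg_dotProduct_self_ne_zero :
    ∫⁻ v : ι → ℝ, ENNReal.ofReal (Real.exp (-(v ⬝ᵥ v) / 2)) ≠ 0 := by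
  have hcont : Measurable fun v : ι → ℝ => ENNReal.ofReal (Real.exp (-(v ⬝ᵥ v) / 2)) := by
    unfold dotProduct; fun_prop
  rw [Ne, lintegral_eq_zero_iff hcont]
  intro h
  have h2 : ∀ᵐ v : ι → ℝ, False := h.mono fun v hv => by
    simp only [Pi.zero_apply, ENNReal.ofReal_eq_zero] at hv
    exact absurd hv (not_le.2 (Real.exp_pos _))
  rw [Filter.eventually_false_iff_eq_bot, ae_eq_bot] at h2
  exact NeZero.ne _ h2

theorem lintegral_exp_neg_dotProduct_self_ne_top :
    ∫⁻ v : ι → ℝ, ENNReal.ofReal (Real.exp (-(v ⬝ᵥ v) / 2)) ≠ ⊤ := by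
  have h : Integrable (fun v : ι → ℝ => ∏ i, Real.exp (-(1 / 2) * v i ^ 2)) volume :=
    Integrable.fintype_prod fun _ => integrable_exp_neg_mul_sq (by norm_num)
  have h2 := h.lintegral_lt_top.ne
  convert h2 using 5 with v
  rw [← Real.exp_sum]
  congr 1
  rw [← Finset.mul_sum]
  simp only [dotProduct, ← sq]
  ring

end LinearAlgebra

/-! ### Ville's inequality and sub-Gaussian noise -/

section Probability

open scoped ENNReal

variable {Ω : Type*} {mΩ : MeasurableSpace Ω} {μ : Measure Ω}

/-- Ville's maximal inequality for a nonnegative supermartingale. -/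
theorem mul_measure_exists_le_le_lintegral {ℱ : Filtration ℕ mΩ} {W : ℕ → Ω → ℝ≥0∞} {T : ℕ}
    (hW : ∀ t ≤ T, Measurable[ℱ t] (W t))
    (hsup : ∀ t < T, ∀ B, MeasurableSet[ℱ t] B → ∫⁻ ω in B, W (t + 1) ω ∂μ ≤ ∫⁻ ω in B, W t ω ∂μ)
    (c : ℝ≥0∞) : c * μ {ω | ∃ t ≤ T, c ≤ W t ω} ≤ ∫⁻ ω, W 0 ω ∂μ := by
  have hD (t : ℕ) (ht : t ≤ T) : MeasurableSet[ℱ t] {ω | ∃ s ≤ t, c ≤ W s ω} := by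
    have : {ω | ∃ s ≤ t, c ≤ W s ω} = ⋃ s ∈ Finset.range (t + 1), {ω | c ≤ W s ω} := by
      ext ω; simp
    rw [this]
    refine Finset.measurableSet_biUnion _ fun s hs => ?_
    have hst : s ≤ t := Nat.lt_succ_iff.1 (Finset.mem_range.1 hs)
    exact ℱ.mono hst _ (hW s (hst.trans ht) measurableSet_Ici)
  -- The invariant stops the process at its first crossing: crossed paths are frozen at `c`, the
  -- others still carry `W t`. The supermartingale property is needed only on the uncrossed event,
  -- which is known at time `t`.
  have key : ∀ t ≤ T, c * μ {ω | ∃ s ≤ t, c ≤ W s ω}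
      + ∫⁻ ω in {ω | ∃ s ≤ t, c ≤ W s ω}ᶜ, W t ω ∂μ ≤ ∫⁻ ω, W 0 ω ∂μ := by
    intro t
    induction t with
    | zero =>
      intro ht
      have hm := ℱ.le 0 _ (hD 0 ht)
      have h1 : c * μ {ω | ∃ s ≤ 0, c ≤ W s ω} ≤ ∫⁻ ω in {ω | ∃ s ≤ 0, c ≤ W s ω}, W 0 ω ∂μ := by
        rw [← setLIntegral_const]
        exact setLIntegral_mono' hm fun ω hω => by simpa using hω
      exact (add_le_add_left h1 _).trans_eq (lintegral_add_compl (W 0) hm)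
    | succ t ih =>
      intro ht
      set D := {ω | ∃ s ≤ t, c ≤ W s ω} with hDdef
      set N := {ω | c ≤ W (t + 1) ω} with hNdef
      have hDm := hD t (by omega)
      have hNm : MeasurableSet N :=
        measurableSet_le measurable_const ((hW (t + 1) ht).mono (ℱ.le _) le_rfl)
      have hunion : {ω | ∃ s ≤ t + 1, c ≤ W s ω} = D ∪ (Dᶜ ∩ N) := by
        ext ω
        simp only [hDdef, hNdef, Set.mem_union, Set.mem_inter_iff, Set.mem_compl_iff]
        constructor
        · rintro ⟨s, hs, h⟩
          by_cases hd : ω ∈ {ω | ∃ s ≤ t, c ≤ W s ω}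
          · exact Or.inl hd
          · refine Or.inr ⟨hd, ?_⟩
            rcases Nat.le_succ_iff.1 hs with h' | h'
            · exact absurd ⟨s, h', h⟩ hd
            · subst h'; exact h
        · rintro (⟨s, hs, h⟩ | ⟨-, h⟩)
          · exact ⟨s, by omega, h⟩
          · exact ⟨t + 1, le_rfl, h⟩
      have hcompl : (D ∪ (Dᶜ ∩ N))ᶜ = Dᶜ \ N := by
        ext ω; simp only [Set.mem_compl_iff, Set.mem_union, Set.mem_inter_iff, Set.mem_sdiff]; tauto
      rw [hunion, hcompl]
      have h1 : c * μ (Dᶜ ∩ N) ≤ ∫⁻ ω in Dᶜ ∩ N, W (t + 1) ω ∂μ := by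
        rw [← setLIntegral_const]
        exact setLIntegral_mono' ((ℱ.le t _ hDm).compl.inter hNm) fun ω hω => hω.2
      calc c * μ (D ∪ (Dᶜ ∩ N)) + ∫⁻ ω in Dᶜ \ N, W (t + 1) ω ∂μ
          ≤ c * (μ D + μ (Dᶜ ∩ N)) + ∫⁻ ω in Dᶜ \ N, W (t + 1) ω ∂μ := by
            gcongr; exact measure_union_le _ _
        _ ≤ c * μ D + (∫⁻ ω in Dᶜ ∩ N, W (t + 1) ω ∂μ + ∫⁻ ω in Dᶜ \ N, W (t + 1) ω ∂μ) := by
            rw [mul_add, add_assoc]; gcongr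
        _ = c * μ D + ∫⁻ ω in Dᶜ, W (t + 1) ω ∂μ := by
            rw [lintegral_inter_add_sdiff _ _ hNm]
        _ ≤ c * μ D + ∫⁻ ω in Dᶜ, W t ω ∂μ := by
            gcongr 1; exact hsup t (by omega) _ hDm.compl
        _ ≤ _ := ih (by omega)
  exact le_self_add.trans (key T le_rfl)

/-- A bound on a conditional expectation can be integrated against any nonnegative measurable
weight. -/
theorem lintegral_mul_le_of_condExp_le [IsFiniteMeasure μ] {m : MeasurableSpace Ω} (hm : m ≤ mΩ)
    {g : Ω → ℝ} (hg : Integrable g μ) (hg0 : ∀ ω, 0 ≤ g ω) {K : ℝ}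
    (hK : μ[g | m] ≤ᵐ[μ] fun _ => K) {f : Ω → ℝ≥0∞} (hf : Measurable[m] f) :
    ∫⁻ ω, f ω * ENNReal.ofReal (g ω) ∂μ ≤ ENNReal.ofReal K * ∫⁻ ω, f ω ∂μ := by
  set ν := μ.withDensity fun ω => ENNReal.ofReal (g ω) with hν
  have hgm : AEMeasurable (fun ω => ENNReal.ofReal (g ω)) μ := hg.aemeasurable.ennreal_ofReal
  -- On the smaller σ-algebra the conditional bound is an inequality of measures, so it passes to
  -- every nonnegative measurable integrand without any integrability of `f`.
  have hle : ν.trim hm ≤ (ENNReal.ofReal K • μ).trim hm := by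
    refine Measure.le_iff.2 fun s hs => ?_
    rw [trim_measurableSet_eq hm hs, trim_measurableSet_eq hm hs, hν,
      withDensity_apply _ (hm s hs), Measure.smul_apply, smul_eq_mul,
      ← ofReal_integral_eq_lintegral_ofReal hg.integrableOn (ae_of_all _ hg0),
      ← setIntegral_condExp hm hg hs]
    have h1 : ∫ ω in s, (μ[g | m]) ω ∂μ ≤ ∫ _ in s, K ∂μ :=
      setIntegral_mono_ae integrable_condExp.integrableOn (integrable_const _).integrableOn hK
    rw [setIntegral_const, smul_eq_mul] at h1
    refine (ENNReal.ofReal_le_ofReal h1).trans ?_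
    rw [ENNReal.ofReal_mul measureReal_nonneg, ofReal_measureReal, mul_comm]
  calc ∫⁻ ω, f ω * ENNReal.ofReal (g ω) ∂μ = ∫⁻ ω, f ω ∂ν := by
        rw [hν, lintegral_withDensity_eq_lintegral_mul₀ hgm (hf.mono hm le_rfl).aemeasurable]
        simp only [Pi.mul_apply, mul_comm]
    _ = ∫⁻ ω, f ω ∂(ν.trim hm) := (lintegral_trim hm hf).symm
    _ ≤ ∫⁻ ω, f ω ∂((ENNReal.ofReal K • μ).trim hm) := lintegral_mono' hle le_rfl
    _ = _ := by rw [lintegral_trim hm hf, lintegral_smul_measure, smul_eq_mul]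

variable {V : Type*} [Fintype V] {G : SimpleGraph V} [DecidableRel G.Adj] {ℱ : Filtration ℕ mΩ}
  {σ : ℝ} {η : ℕ → V × V → Ω → ℝ} {β : Type*} [MeasurableSpace β]

/-- The noise hypothesis concerns deterministic coefficients, whereas the coefficients here depend
on the past through `q`. Since `q` takes finitely many values, the deterministic bound applies on
each of its level sets. -/
theorem IsSubGaussianNoise.lintegral_mul_exp_le [IsProbabilityMeasure μ]
    [MeasurableSingletonClass β] (hη : IsSubGaussianNoise G μ ℱ σ η) (t : ℕ) {q : Ω → β}
    (hq : Measurable[ℱ t] q) {P : Finset β} (hP : ∀ ω, q ω ∈ P) (c : β → V × V → ℝ)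
    {f : Ω → ℝ≥0∞} (hf : Measurable[ℱ t] f) :
    ∫⁻ ω, f ω * ENNReal.ofReal (Real.exp (∑ e ∈ edges G,
      (c (q ω) e * η t e ω - σ ^ 2 * c (q ω) e ^ 2 / 2))) ∂μ ≤ ∫⁻ ω, f ω ∂μ := by
  classical
  have hqs (b : β) : MeasurableSet[ℱ t] (q ⁻¹' {b}) := hq (measurableSet_singleton b)
  have hind (g : Ω → ℝ≥0∞) (ω : Ω) : g ω = ∑ b ∈ P, (q ⁻¹' {b}).indicator g ω := by
    rw [Finset.sum_eq_single (q ω)]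
    · simp
    · intro b _ hb
      exact Set.indicator_of_notMem (fun h => hb (by simpa using h.symm)) _
    · exact fun h => absurd (hP ω) h
  have hηm (e : V × V) (he : e ∈ edges G) : Measurable (η t e) :=
    (hη.measurable t e he).mono (ℱ.le _) le_rfl
  have hfm := hf.mono (ℱ.le t) le_rfl
  have key (b : β) : ∫⁻ ω, (q ⁻¹' {b}).indicator f ω * ENNReal.ofReal (Real.exp (∑ e ∈ edges G,
      (c b e * η t e ω - σ ^ 2 * c b e ^ 2 / 2))) ∂μ ≤ ∫⁻ ω, (q ⁻¹' {b}).indicator f ω ∂μ := by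
    have h := lintegral_mul_le_of_condExp_le (ℱ.le t) (hη.integrable t (c b))
      (fun ω => Real.exp_nonneg _) (hη.condExp_le t (c b)) (hf.indicator (hqs b))
    have hs (ω : Ω) : (q ⁻¹' {b}).indicator f ω * ENNReal.ofReal (Real.exp (∑ e ∈ edges G,
        (c b e * η t e ω - σ ^ 2 * c b e ^ 2 / 2)))
        = ENNReal.ofReal (Real.exp (-(σ ^ 2 * (∑ e ∈ edges G, c b e ^ 2) / 2)))
          * ((q ⁻¹' {b}).indicator f ω
            * ENNReal.ofReal (Real.exp (∑ e ∈ edges G, c b e * η t e ω))) := by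
      rw [mul_left_comm, ← ENNReal.ofReal_mul (Real.exp_nonneg _), ← Real.exp_add,
        Finset.sum_sub_distrib, Finset.mul_sum, Finset.sum_div]
      congr 3
      ring
    simp_rw [hs]
    rw [lintegral_const_mul' _ _ ENNReal.ofReal_ne_top]
    refine (mul_le_mul_right h _).trans_eq ?_
    rw [← mul_assoc, ← ENNReal.ofReal_mul (Real.exp_nonneg _), ← Real.exp_add, neg_add_cancel,
      Real.exp_zero, ENNReal.ofReal_one, one_mul]
  calc ∫⁻ ω, f ω * ENNReal.ofReal (Real.exp (∑ e ∈ edges G,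
        (c (q ω) e * η t e ω - σ ^ 2 * c (q ω) e ^ 2 / 2))) ∂μ
      = ∫⁻ ω, ∑ b ∈ P, (q ⁻¹' {b}).indicator f ω * ENNReal.ofReal (Real.exp (∑ e ∈ edges G,
        (c b e * η t e ω - σ ^ 2 * c b e ^ 2 / 2))) ∂μ := by
        refine lintegral_congr fun ω => ?_
        rw [hind f ω, Finset.sum_mul]
        refine Finset.sum_congr rfl fun b _ => ?_
        by_cases hb : q ω = b
        · rw [hb]
        · rw [Set.indicator_of_notMem (by simpa using hb), zero_mul, zero_mul]
    _ = ∑ b ∈ P, ∫⁻ ω, (q ⁻¹' {b}).indicator f ω * ENNReal.ofReal (Real.exp (∑ e ∈ edges G,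
        (c b e * η t e ω - σ ^ 2 * c b e ^ 2 / 2))) ∂μ := by
        refine lintegral_finsetSum _ fun b _ => (hfm.indicator (ℱ.le t _ (hqs b))).mul ?_
        refine (Real.measurable_exp.comp ?_).ennreal_ofReal
        exact Finset.measurable_fun_sum _ fun e he => ((hηm e he).const_mul _).sub_const _
    _ ≤ ∑ b ∈ P, ∫⁻ ω, (q ⁻¹' {b}).indicator f ω ∂μ := Finset.sum_le_sum fun b _ => key b
    _ = ∫⁻ ω, f ω ∂μ := by
        rw [← lintegral_finsetSum _ fun b _ => hfm.indicator (ℱ.le t _ (hqs b))]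
        exact lintegral_congr fun ω => (hind f ω).symm

/-- With `σ = 0` the nonnegative function `exp η + exp (-η) - 2` has integral at most zero, and it
vanishes only where `η` does. -/
theorem IsSubGaussianNoise.ae_eq_zero [IsProbabilityMeasure μ]
    (hη : IsSubGaussianNoise G μ ℱ 0 η) (t : ℕ) {e : V × V} (he : e ∈ edges G) :
    η t e =ᵐ[μ] 0 := by
  classical
  have hint (a : ℝ) : Integrable (fun ω => Real.exp (a * η t e ω)) μ
      ∧ ∫ ω, Real.exp (a * η t e ω) ∂μ ≤ 1 := by
    have hs (ω : Ω) : ∑ e' ∈ edges G, (if e' = e then a else 0) * η t e' ω = a * η t e ω := by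
      simp [ite_mul, he]
    have h1 := hη.integrable t fun e' => if e' = e then a else 0
    have h2 := hη.condExp_le t fun e' => if e' = e then a else 0
    simp only [hs] at h1 h2
    refine ⟨h1, ?_⟩
    rw [← integral_condExp (ℱ.le t)]
    refine (integral_mono_ae integrable_condExp (integrable_const _) h2).trans ?_
    simp
  obtain ⟨h1, h1'⟩ := hint 1
  obtain ⟨h2, h2'⟩ := hint (-1)
  have hnn (ω : Ω) : 0 ≤ Real.exp (1 * η t e ω) + Real.exp (-1 * η t e ω) - 2 := by
    have := Real.add_one_le_exp (1 * η t e ω)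
    have := Real.add_one_le_exp (-1 * η t e ω)
    linarith
  have hz : ∫ ω, (Real.exp (1 * η t e ω) + Real.exp (-1 * η t e ω) - 2) ∂μ = 0 := by
    refine le_antisymm ?_ (integral_nonneg hnn)
    have h3 : ∫ ω, (Real.exp (1 * η t e ω) + Real.exp (-1 * η t e ω) - 2) ∂μ
        = ∫ ω, Real.exp (1 * η t e ω) ∂μ + ∫ ω, Real.exp (-1 * η t e ω) ∂μ - 2 := by
      refine (integral_sub (h1.add h2) (integrable_const _)).trans ?_
      refine congrArg₂ _ (integral_add h1 h2) ?_
      simp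
    rw [h3]
    linarith
  rw [integral_eq_zero_iff_of_nonneg hnn ((h1.add h2).sub (integrable_const _))] at hz
  filter_upwards [hz] with ω hω
  simp only [Pi.zero_apply] at hω ⊢
  by_contra hne
  have := Real.add_one_lt_exp (x := 1 * η t e ω) (by simpa using hne)
  have := Real.add_one_lt_exp (x := -1 * η t e ω) (by simpa using hne)
  linarith

end Probability

/-! ### The method of mixtures -/

noncomputable section SelfNormalized

open scoped ENNReal

variable {Ω : Type*} {mΩ : MeasurableSpace Ω} {μ : Measure Ω}
  {V : Type*} [Fintype V] {G : SimpleGraph V} [DecidableRel G.Adj] {ℱ : Filtration ℕ mΩ}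
  {σ : ℝ} {η : ℕ → V × V → Ω → ℝ} {β : Type*} {ι : Type*}

/-- The regularized Gram matrix of the vectors `z (p s) e`, `s < t`, `e ∈ E`. -/
def gramMatrix [DecidableEq ι] (G : SimpleGraph V) [DecidableRel G.Adj] (lam : ℝ) (z : β → V × V → ι → ℝ)
    (p : ℕ → β) (t : ℕ) : Matrix ι ι ℝ :=
  lam • (1 : Matrix ι ι ℝ) + ∑ s ∈ Finset.range t, ∑ e ∈ edges G,
    vecMulVec (z (p s) e) (z (p s) e)

/-- The vectors `z (p s) e`, `s < t`, `e ∈ E`, weighted by the noise. -/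
def weightedSum (G : SimpleGraph V) [DecidableRel G.Adj] (z : β → V × V → ι → ℝ)
    (p : ℕ → β) (n : ℕ → V × V → ℝ) (t : ℕ) : ι → ℝ :=
  ∑ s ∈ Finset.range t, ∑ e ∈ edges G, n s e • z (p s) e

theorem gramMatrix_succ [DecidableEq ι] (lam : ℝ) (z : β → V × V → ι → ℝ) (p : ℕ → β) (t : ℕ) :
    gramMatrix G lam z p (t + 1) = gramMatrix G lam z p t
      + ∑ e ∈ edges G, vecMulVec (z (p t) e) (z (p t) e) := by
  rw [gramMatrix, gramMatrix, Finset.sum_range_succ, add_assoc]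

variable [Fintype ι]

theorem dotProduct_weightedSum (z : β → V × V → ι → ℝ) (p : ℕ → β) (n : ℕ → V × V → ℝ) (t : ℕ)
    (u : ι → ℝ) : u ⬝ᵥ weightedSum G z p n t
      = ∑ s ∈ Finset.range t, ∑ e ∈ edges G, n s e * (u ⬝ᵥ z (p s) e) := by
  simp only [weightedSum, dotProduct_sum, dotProduct_smul, smul_eq_mul]

variable [DecidableEq ι]

theorem posDef_gramMatrix {lam : ℝ} (hlam : 0 < lam) (z : β → V × V → ι → ℝ) (p : ℕ → β) (t : ℕ) :
    (gramMatrix G lam z p t).PosDef := by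
  refine (PosDef.one.smul hlam).add_posSemidef ?_
  exact posSemidef_sum _ fun s _ => posSemidef_sum_vecMulVec_self _ _

theorem dotProduct_gramMatrix_mulVec (lam : ℝ) (z : β → V × V → ι → ℝ) (p : ℕ → β) (t : ℕ)
    (u : ι → ℝ) : u ⬝ᵥ (gramMatrix G lam z p t *ᵥ u)
      = lam * (u ⬝ᵥ u) + ∑ s ∈ Finset.range t, ∑ e ∈ edges G, (u ⬝ᵥ z (p s) e) ^ 2 := by
  rw [gramMatrix, add_mulVec, dotProduct_add, smul_mulVec, one_mulVec, dotProduct_smul,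
    smul_eq_mul, sum_mulVec, dotProduct_sum]
  congr 1
  refine Finset.sum_congr rfl fun s _ => ?_
  rw [sum_mulVec, dotProduct_sum]
  refine Finset.sum_congr rfl fun e _ => ?_
  rw [vecMulVec_mulVec, dotProduct_smul, dotProduct_comm (z (p s) e) u]
  simp [sq]

/-- The exponential process whose integral over `u` is the Gaussian mixture. -/
def mixand (G : SimpleGraph V) [DecidableRel G.Adj] (σ lam : ℝ) (z : β → V × V → ι → ℝ)
    (p : ℕ → β) (n : ℕ → V × V → ℝ) (t : ℕ) (u : ι → ℝ) : ℝ≥0∞ :=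
  ENNReal.ofReal (Real.exp (u ⬝ᵥ (σ⁻¹ • weightedSum G z p n t)
    - u ⬝ᵥ (gramMatrix G lam z p t *ᵥ u) / 2))

/-- With coefficients `σ⁻¹ * (u ⬝ᵥ z)`, the sub-Gaussian compensator is exactly half the increment
of the quadratic form of the Gram matrix. -/
theorem mixand_succ (hσ : σ ≠ 0) (lam : ℝ) (z : β → V × V → ι → ℝ) (p : ℕ → β) (n : ℕ → V × V → ℝ)
    (t : ℕ) (u : ι → ℝ) :
    mixand G σ lam z p n (t + 1) u = mixand G σ lam z p n t u
      * ENNReal.ofReal (Real.exp (∑ e ∈ edges G, (σ⁻¹ * (u ⬝ᵥ z (p t) e) * n t e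
        - σ ^ 2 * (σ⁻¹ * (u ⬝ᵥ z (p t) e)) ^ 2 / 2))) := by
  rw [mixand, mixand, ← ENNReal.ofReal_mul (Real.exp_nonneg _), ← Real.exp_add]
  congr 2
  rw [dotProduct_smul, dotProduct_smul, dotProduct_weightedSum, dotProduct_weightedSum,
    dotProduct_gramMatrix_mulVec, dotProduct_gramMatrix_mulVec, Finset.sum_range_succ,
    Finset.sum_range_succ, Finset.sum_sub_distrib]
  have h1 : ∑ e ∈ edges G, σ⁻¹ * (u ⬝ᵥ z (p t) e) * n t e
      = σ⁻¹ * ∑ e ∈ edges G, n t e * (u ⬝ᵥ z (p t) e) := by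
    rw [Finset.mul_sum]; exact Finset.sum_congr rfl fun e _ => by ring
  have h2 : ∑ e ∈ edges G, σ ^ 2 * (σ⁻¹ * (u ⬝ᵥ z (p t) e)) ^ 2 / 2
      = (∑ e ∈ edges G, (u ⬝ᵥ z (p t) e) ^ 2) / 2 := by
    rw [Finset.sum_div]; exact Finset.sum_congr rfl fun e _ => by field_simp
  rw [h1, h2, smul_eq_mul, smul_eq_mul]
  ring

theorem measurable_mixand [MeasurableSpace β] {m : MeasurableSpace Ω} (σ lam : ℝ) {z : β → V × V → ι → ℝ}
    (hz : ∀ e, Measurable fun b => z b e) {q : ℕ → Ω → β} {t : ℕ}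
    (hq : ∀ s < t, Measurable (q s)) (hη : ∀ s < t, ∀ e ∈ edges G, Measurable (η s e)) :
    Measurable fun a : Ω × (ι → ℝ) =>
      mixand G σ lam z (fun s => q s a.1) (fun s e => η s e a.1) t a.2 := by
  unfold mixand
  simp only [dotProduct_smul, dotProduct_weightedSum, dotProduct_gramMatrix_mulVec]
  have hdot : Measurable fun a : Ω × (ι → ℝ) => a.2 ⬝ᵥ a.2 := by unfold dotProduct; fun_prop
  have hdz (s : ℕ) (hs : s < t) (e : V × V) :
      Measurable fun a : Ω × (ι → ℝ) => a.2 ⬝ᵥ z (q s a.1) e := by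
    have h1 : Measurable fun a : Ω × (ι → ℝ) => z (q s a.1) e :=
      (hz e).comp ((hq s hs).comp measurable_fst)
    have h2 (i : ι) : Measurable fun a : Ω × (ι → ℝ) => z (q s a.1) e i :=
      (measurable_pi_apply i).comp h1
    unfold dotProduct
    fun_prop
  have h1 : Measurable fun a : Ω × (ι → ℝ) => ∑ s ∈ Finset.range t, ∑ e ∈ edges G,
      η s e a.1 * (a.2 ⬝ᵥ z (q s a.1) e) :=
    Finset.measurable_fun_sum _ fun s hs => Finset.measurable_fun_sum _ fun e he =>
      ((hη s (Finset.mem_range.1 hs) e he).comp measurable_fst).mul (hdz s (Finset.mem_range.1 hs) e)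
  have h2 : Measurable fun a : Ω × (ι → ℝ) => ∑ s ∈ Finset.range t, ∑ e ∈ edges G,
      (a.2 ⬝ᵥ z (q s a.1) e) ^ 2 :=
    Finset.measurable_fun_sum _ fun s hs => Finset.measurable_fun_sum _ fun e he =>
      (hdz s (Finset.mem_range.1 hs) e).pow_const 2
  exact (Real.measurable_exp.comp
    ((h1.const_smul σ⁻¹).sub (((hdot.const_mul lam).add h2).div_const 2))).ennreal_ofReal

/-- For each fixed `u` the mixand is a supermartingale, hence so is its integral over `u`. The
regularisation in the Gram matrix acts as the Gaussian prior, and the integral is explicit by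
completing the square. -/
theorem IsSubGaussianNoise.measure_exists_le_mixture [IsProbabilityMeasure μ]
    [MeasurableSpace β] [MeasurableSingletonClass β] (hη : IsSubGaussianNoise G μ ℱ σ η)
    (hσ : 0 < σ) {lam δ : ℝ}
    (hlam : 0 < lam) (hδ : 0 < δ) {z : β → V × V → ι → ℝ} (hz : ∀ e, Measurable fun b => z b e)
    {T : ℕ} {q : ℕ → Ω → β} (hq : ∀ t < T, Measurable[ℱ t] (q t)) {P : Finset β}
    (hP : ∀ t < T, ∀ ω, q t ω ∈ P) :
    μ {ω | ∃ t ≤ T, 1 / δ * √(gramMatrix G lam z (fun s => q s ω) t).det / √(lam ^ Fintype.card ι)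
      ≤ Real.exp ((σ⁻¹ • weightedSum G z (fun s => q s ω) (fun s e => η s e ω) t) ⬝ᵥ
        ((gramMatrix G lam z (fun s => q s ω) t)⁻¹ *ᵥ
          (σ⁻¹ • weightedSum G z (fun s => q s ω) (fun s e => η s e ω) t)) / 2)}
      ≤ ENNReal.ofReal δ := by
  set K := ∫⁻ v : ι → ℝ, ENNReal.ofReal (Real.exp (-(v ⬝ᵥ v) / 2)) with hK
  have hK0 : K ≠ 0 := lintegral_exp_neg_dotProduct_self_ne_zero
  have hKtop : K ≠ ⊤ := lintegral_exp_neg_dotProduct_self_ne_top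
  have hl : 0 < √(lam ^ Fintype.card ι) := Real.sqrt_pos.2 (pow_pos hlam _)
  set W : ℕ → Ω → ℝ≥0∞ := fun t ω =>
    ∫⁻ u, mixand G σ lam z (fun s => q s ω) (fun s e => η s e ω) t u with hW
  have hWeq (t : ℕ) (ω : Ω) := lintegral_exp_linear_sub_quadratic
    (posDef_gramMatrix (G := G) hlam z (fun s => q s ω) t)
    (σ⁻¹ • weightedSum G z (fun s => q s ω) (fun s e => η s e ω) t)
  -- The σ-algebra is left free: `ℱ t` gives adaptedness, the ambient one allows Tonelli. The noise
  -- of round `s` is known at `s + 1`, so `t` completed rounds are known at time `t`.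
  have hmeas {m : MeasurableSpace Ω} (t : ℕ) (ht : t ≤ T) (hm : ∀ s < t, ℱ (s + 1) ≤ m) :
      Measurable fun a : Ω × (ι → ℝ) =>
        mixand G σ lam z (fun s => q s a.1) (fun s e => η s e a.1) t a.2 :=
    measurable_mixand σ lam hz
      (fun s hs => (hq s (hs.trans_le ht)).mono ((ℱ.mono (Nat.le_succ s)).trans (hm s hs)) le_rfl)
      (fun s hs e he => (hη.measurable s e he).mono (hm s hs) le_rfl)
  have hWm {m : MeasurableSpace Ω} (t : ℕ) (ht : t ≤ T) (hm : ∀ s < t, ℱ (s + 1) ≤ m) :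
      Measurable[m] (W t) := (hmeas t ht hm).lintegral_prod_right'
  have hmu {m : MeasurableSpace Ω} (t : ℕ) (ht : t ≤ T) (hm : ∀ s < t, ℱ (s + 1) ≤ m)
      (u : ι → ℝ) : Measurable[m] fun ω =>
        mixand G σ lam z (fun s => q s ω) (fun s e => η s e ω) t u :=
    (hmeas t ht hm).of_uncurry_right
  have hle (t : ℕ) : ∀ s < t, ℱ (s + 1) ≤ ℱ t := fun s hs => ℱ.mono hs
  -- The level is the constant initial value `W 0 = K / √(lam ^ N)`, with `N` the dimension, divided
  -- by `δ`.
  have hvil := mul_measure_exists_le_le_lintegral (μ := μ) (ℱ := ℱ) (W := W) (T := T)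
    (fun t ht => hWm (m := ℱ t) t ht (hle t)) ?_
    (K * ENNReal.ofReal (1 / δ / √(lam ^ Fintype.card ι)))
  · have hW0 : ∫⁻ ω, W 0 ω ∂μ = ENNReal.ofReal (1 / √(lam ^ Fintype.card ι)) * K := by
      have h0 (ω : Ω) : W 0 ω = ENNReal.ofReal (1 / √(lam ^ Fintype.card ι)) * K := by
        refine (hWeq 0 ω).trans ?_
        simp [gramMatrix, weightedSum, K]
      simp_rw [h0]
      simp
    rw [hW0] at hvil
    have hc : K * ENNReal.ofReal (1 / δ / √(lam ^ Fintype.card ι))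
        = (ENNReal.ofReal (1 / √(lam ^ Fintype.card ι)) * K) * ENNReal.ofReal (1 / δ) := by
      rw [mul_comm _ K, mul_assoc, ← ENNReal.ofReal_mul (by positivity)]
      congr 2
      ring
    have hc0 : ENNReal.ofReal (1 / √(lam ^ Fintype.card ι)) * K ≠ 0 :=
      mul_ne_zero (by simpa using hl) hK0
    have hct : ENNReal.ofReal (1 / √(lam ^ Fintype.card ι)) * K ≠ ⊤ :=
      ENNReal.mul_ne_top ENNReal.ofReal_ne_top hKtop
    rw [hc, mul_assoc] at hvil
    have h1 : ENNReal.ofReal (1 / δ) * μ {ω | ∃ t ≤ T,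
        ENNReal.ofReal (1 / √(lam ^ Fintype.card ι)) * K * ENNReal.ofReal (1 / δ) ≤ W t ω} ≤ 1 := by
      rw [← ENNReal.mul_le_mul_iff_right hc0 hct, mul_one]
      exact hvil
    have h2 : μ {ω | ∃ t ≤ T,
        ENNReal.ofReal (1 / √(lam ^ Fintype.card ι)) * K * ENNReal.ofReal (1 / δ) ≤ W t ω}
        ≤ ENNReal.ofReal δ := by
      calc _ = ENNReal.ofReal δ * (ENNReal.ofReal (1 / δ) * _) := by
            rw [← mul_assoc, ← ENNReal.ofReal_mul hδ.le, mul_one_div_cancel hδ.ne',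
              ENNReal.ofReal_one, one_mul]
        _ ≤ ENNReal.ofReal δ * 1 := by gcongr
        _ = _ := mul_one _
    refine (measure_mono ?_).trans h2
    rintro ω ⟨t, ht, h⟩
    refine ⟨t, ht, ?_⟩
    rw [← hc]
    refine le_trans ?_ (hWeq t ω).ge
    rw [mul_comm]
    refine mul_le_mul (ENNReal.ofReal_le_ofReal ?_) le_rfl zero_le zero_le
    have hdet : 0 < √(gramMatrix G lam z (fun s => q s ω) t).det :=
      Real.sqrt_pos.2 (posDef_gramMatrix hlam _ _ _).det_pos
    refine (le_div_iff₀ hdet).2 ?_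
    refine le_trans (le_of_eq ?_) h
    ring
  · intro t ht B hB
    have hmeas' (t : ℕ) (ht : t ≤ T) : Measurable fun a : Ω × (ι → ℝ) =>
        mixand G σ lam z (fun s => q s a.1) (fun s e => η s e a.1) t a.2 :=
      hmeas t ht fun s _ => ℱ.le _
    -- Tonelli reduces the supermartingale property of the mixture to that of each mixand.
    have hswap (t : ℕ) (ht : t ≤ T) : ∫⁻ ω in B, W t ω ∂μ
        = ∫⁻ u, ∫⁻ ω in B, mixand G σ lam z (fun s => q s ω) (fun s e => η s e ω) t u ∂μ :=
      lintegral_lintegral_swap (hmeas' t ht).aemeasurable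
    rw [hswap (t + 1) ht, hswap t ht.le]
    refine lintegral_mono fun u => ?_
    have hmut : Measurable[ℱ t] fun ω =>
        mixand G σ lam z (fun s => q s ω) (fun s e => η s e ω) t u :=
      hmu (m := ℱ t) t ht.le (hle t) u
    have h := hη.lintegral_mul_exp_le t (hq t ht) (hP t ht) (fun b e => σ⁻¹ * (u ⬝ᵥ z b e))
      (hmut.indicator hB)
    have hBm := ℱ.le t _ hB
    rw [lintegral_indicator hBm] at h
    refine le_trans (le_of_eq ?_) h
    rw [← lintegral_indicator hBm]
    refine lintegral_congr fun ω => ?_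
    by_cases hω : ω ∈ B
    · rw [Set.indicator_of_mem hω, Set.indicator_of_mem hω, mixand_succ hσ.ne']
    · rw [Set.indicator_of_notMem hω, Set.indicator_of_notMem hω, zero_mul]

end SelfNormalized

/-! ### Least squares and the elliptical potential -/

section EllipticalPotential

variable {V : Type*} [Fintype V] {G : SimpleGraph V} [DecidableRel G.Adj]
  {β : Type*} {ι : Type*} [Fintype ι] [DecidableEq ι]

theorem det_gramMatrix_le [Nonempty ι] {lam L : ℝ} (hlam : 0 < lam) {z : β → V × V → ι → ℝ}
    {p : ℕ → β} {t : ℕ} (hz : ∀ s < t, ∀ e ∈ edges G, z (p s) e ⬝ᵥ z (p s) e ≤ L ^ 2) :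
    (gramMatrix G lam z p t).det ≤ lam ^ Fintype.card ι
      * (1 + t * (edges G).card * L ^ 2 / lam / Fintype.card ι) ^ Fintype.card ι := by
  have hc : (0 : ℝ) < Fintype.card ι := by exact_mod_cast Fintype.card_pos
  have hA := (posDef_gramMatrix (G := G) hlam z p t).posSemidef
  have htr : (gramMatrix G lam z p t).trace
      ≤ lam * Fintype.card ι + t * (edges G).card * L ^ 2 := by
    rw [gramMatrix, trace_add, trace_smul, trace_one, smul_eq_mul, trace_sum]
    have h : ∑ s ∈ Finset.range t, (∑ e ∈ edges G, vecMulVec (z (p s) e) (z (p s) e)).trace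
        ≤ ∑ s ∈ Finset.range t, ∑ e ∈ edges G, L ^ 2 := by
      refine Finset.sum_le_sum fun s hs => ?_
      rw [trace_sum]
      refine Finset.sum_le_sum fun e he => ?_
      rw [trace_vecMulVec]
      exact hz s (Finset.mem_range.1 hs) e he
    simp only [Finset.sum_const, Finset.card_range, nsmul_eq_mul] at h
    linarith
  have htr0 : 0 ≤ (gramMatrix G lam z p t).trace := hA.trace_nonneg
  refine (det_le_trace_div_card_pow hA).trans ?_
  rw [← mul_pow]
  refine pow_le_pow_left₀ (by positivity) ?_ _
  rw [div_le_iff₀ hc]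
  refine htr.trans_eq ?_
  field_simp

/-- Each round multiplies the determinant by at least `1 + w`, starting from `det (lam • 1)`. -/
theorem prod_one_add_le_det_gramMatrix {lam : ℝ} (hlam : 0 < lam) (z : β → V × V → ι → ℝ)
    (p : ℕ → β) (t : ℕ) :
    lam ^ Fintype.card ι * ∏ s ∈ Finset.range t,
      (1 + ∑ e ∈ edges G, z (p s) e ⬝ᵥ ((gramMatrix G lam z p s)⁻¹ *ᵥ z (p s) e))
      ≤ (gramMatrix G lam z p t).det := by
  induction t with
  | zero => simp [gramMatrix]
  | succ t ih =>
    have hA := posDef_gramMatrix (G := G) hlam z p t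
    rw [Finset.prod_range_succ, ← mul_assoc, gramMatrix_succ]
    refine le_trans (mul_le_mul_of_nonneg_right ih ?_) (det_mul_one_add_sum_le hA _ _)
    have : 0 ≤ ∑ e ∈ edges G, z (p t) e ⬝ᵥ ((gramMatrix G lam z p t)⁻¹ *ᵥ z (p t) e) :=
      Finset.sum_nonneg fun e _ => by simpa using hA.inv.posSemidef.dotProduct_mulVec_nonneg _
    linarith

/-- The Gram matrix dominates `lam • 1`: with `v = A⁻¹ *ᵥ u` this gives `lam * (v ⬝ᵥ v) ≤ u ⬝ᵥ v`,
and Cauchy–Schwarz for `u` and `v` finishes. -/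
theorem dotProduct_inv_gramMatrix_le {lam : ℝ} (hlam : 0 < lam) (z : β → V × V → ι → ℝ)
    (p : ℕ → β) (t : ℕ) (u : ι → ℝ) :
    lam * (u ⬝ᵥ ((gramMatrix G lam z p t)⁻¹ *ᵥ u)) ≤ u ⬝ᵥ u := by
  have hA := posDef_gramMatrix (G := G) hlam z p t
  set A := gramMatrix G lam z p t with hAdef
  set v := A⁻¹ *ᵥ u with hv
  have hAv : A *ᵥ v = u := by
    rw [hv, mulVec_mulVec, Matrix.mul_nonsing_inv _ hA.det_pos.ne'.isUnit, one_mulVec]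
  have h1 : lam * (v ⬝ᵥ v) ≤ u ⬝ᵥ v := by
    have h := dotProduct_gramMatrix_mulVec (G := G) lam z p t v
    rw [← hAdef, hAv, dotProduct_comm] at h
    have : 0 ≤ ∑ s ∈ Finset.range t, ∑ e ∈ edges G, (v ⬝ᵥ z (p s) e) ^ 2 :=
      Finset.sum_nonneg fun _ _ => Finset.sum_nonneg fun _ _ => sq_nonneg _
    linarith
  have h2 := dotProduct_sq_le u v
  have hvv : 0 ≤ v ⬝ᵥ v := Finset.sum_nonneg fun i _ => mul_self_nonneg _
  have huu : 0 ≤ u ⬝ᵥ u := Finset.sum_nonneg fun i _ => mul_self_nonneg _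
  have h3 : 0 ≤ u ⬝ᵥ v := le_trans (by positivity) h1
  rcases h3.eq_or_lt with h0 | h0
  · rw [← h0, mul_zero]; exact huu
  · refine le_of_mul_le_mul_right ?_ h0
    nlinarith [mul_le_mul_of_nonneg_left h1 huu]

/-- The error of the regularized least squares estimator. -/
theorem weightedNorm_estimator_sub_le {lam : ℝ} (hlam : 0 < lam) (z : β → V × V → ι → ℝ)
    (p : ℕ → β) (t : ℕ) (n : ℕ → V × V → ℝ) (θ : ι → ℝ) :
    weightedNorm (gramMatrix G lam z p t) (θ - (gramMatrix G lam z p t)⁻¹ *ᵥ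
      ∑ s ∈ Finset.range t, ∑ e ∈ edges G, (z (p s) e ⬝ᵥ θ + n s e) • z (p s) e)
      ≤ weightedNorm (gramMatrix G lam z p t)⁻¹ (weightedSum G z p n t)
        + √lam * √(θ ⬝ᵥ θ) := by
  have hA := posDef_gramMatrix (G := G) hlam z p t
  have hu : IsUnit (gramMatrix G lam z p t).det := hA.det_pos.ne'.isUnit
  have hsum : ∑ s ∈ Finset.range t, ∑ e ∈ edges G, (z (p s) e ⬝ᵥ θ + n s e) • z (p s) e
      = gramMatrix G lam z p t *ᵥ θ - lam • θ + weightedSum G z p n t := by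
    rw [gramMatrix, add_mulVec, smul_mulVec, one_mulVec, add_sub_cancel_left, sum_mulVec,
      weightedSum, ← Finset.sum_add_distrib]
    refine Finset.sum_congr rfl fun s _ => ?_
    rw [sum_mulVec, ← Finset.sum_add_distrib]
    refine Finset.sum_congr rfl fun e _ => ?_
    rw [vecMulVec_mulVec, add_smul]
    simp
  have hnorm (w : ι → ℝ) : weightedNorm (gramMatrix G lam z p t)
      ((gramMatrix G lam z p t)⁻¹ *ᵥ w) = weightedNorm (gramMatrix G lam z p t)⁻¹ w := by
    rw [weightedNorm, weightedNorm, mulVec_mulVec, Matrix.mul_nonsing_inv _ hu, one_mulVec,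
      dotProduct_comm]
  have hneg (A : Matrix ι ι ℝ) (w : ι → ℝ) : weightedNorm A (-w) = weightedNorm A w := by
    simp [weightedNorm, mulVec_neg]
  have hθ : weightedNorm (gramMatrix G lam z p t)⁻¹ (lam • θ) ≤ √lam * √(θ ⬝ᵥ θ) := by
    rw [weightedNorm, ← Real.sqrt_mul hlam.le, mulVec_smul, dotProduct_smul, smul_dotProduct,
      smul_eq_mul, smul_eq_mul]
    exact Real.sqrt_le_sqrt (mul_le_mul_of_nonneg_left
      (dotProduct_inv_gramMatrix_le hlam z p t θ) hlam.le)
  have hsplit : θ - (gramMatrix G lam z p t)⁻¹ *ᵥ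
      (gramMatrix G lam z p t *ᵥ θ - lam • θ + weightedSum G z p n t)
      = (gramMatrix G lam z p t)⁻¹ *ᵥ (-weightedSum G z p n t + lam • θ) := by
    rw [mulVec_add, mulVec_add, mulVec_sub, mulVec_mulVec, Matrix.nonsing_inv_mul _ hu, one_mulVec,
      mulVec_neg]
    abel
  rw [hsum, hsplit, hnorm]
  refine (weightedNorm_add_le hA.inv _ _).trans ?_
  rw [hneg]
  exact add_le_add le_rfl hθ

/-- The radius of the noise term that follows from the bound on the Gaussian mixture. -/
theorem weightedNorm_weightedSum_le [Nonempty ι] (hι : 2 ≤ Fintype.card ι) {σ lam L δ : ℝ}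
    (hσ : 0 < σ) (hlam : 0 < lam) (hδ : 0 < δ) (hδ1 : δ ≤ 1) {z : β → V × V → ι → ℝ}
    {p : ℕ → β} {t : ℕ} (hz : ∀ s < t, ∀ e ∈ edges G, z (p s) e ⬝ᵥ z (p s) e ≤ L ^ 2)
    {n : ℕ → V × V → ℝ}
    (hexp : Real.exp ((σ⁻¹ • weightedSum G z p n t) ⬝ᵥ ((gramMatrix G lam z p t)⁻¹ *ᵥ
      (σ⁻¹ • weightedSum G z p n t)) / 2)
      ≤ 1 / δ * √(gramMatrix G lam z p t).det / √(lam ^ Fintype.card ι)) :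
    weightedNorm (gramMatrix G lam z p t)⁻¹ (weightedSum G z p n t)
      ≤ σ * √(Fintype.card ι * Real.log ((1 + t * (edges G).card * L ^ 2 / lam) / δ)) := by
  set N := Fintype.card ι with hN
  set S := weightedSum G z p n t with hS
  set A := gramMatrix G lam z p t with hA
  set y : ℝ := t * (edges G).card * L ^ 2 / lam with hy
  have hy0 : 0 ≤ y := by positivity
  have hN1 : (1 : ℝ) ≤ N := by exact_mod_cast (by omega : 1 ≤ N)
  have hdet : A.det ≤ lam ^ N * (1 + y / N) ^ N := det_gramMatrix_le hlam hz
  have hdet0 : 0 ≤ A.det := (posDef_gramMatrix (G := G) hlam z p t).det_pos.le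
  have hlN : 0 < lam ^ N := pow_pos hlam _
  have hg : (σ⁻¹ • S) ⬝ᵥ (A⁻¹ *ᵥ (σ⁻¹ • S)) = (S ⬝ᵥ (A⁻¹ *ᵥ S)) / σ ^ 2 := by
    rw [mulVec_smul, dotProduct_smul, smul_dotProduct, smul_eq_mul, smul_eq_mul]
    field_simp
  rw [hg] at hexp
  have hsq : Real.exp ((S ⬝ᵥ (A⁻¹ *ᵥ S)) / σ ^ 2) ≤ ((1 + y) / δ) ^ N := by
    have h1 := pow_le_pow_left₀ (Real.exp_nonneg _) hexp 2
    rw [← Real.exp_nat_mul, div_pow, mul_pow, Real.sq_sqrt hdet0, Real.sq_sqrt hlN.le] at h1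
    have h2 : ((2 : ℕ) : ℝ) * ((S ⬝ᵥ (A⁻¹ *ᵥ S)) / σ ^ 2 / 2) = (S ⬝ᵥ (A⁻¹ *ᵥ S)) / σ ^ 2 := by
      push_cast; ring
    rw [h2] at h1
    have hyN : 1 + y / N ≤ 1 + y := by
      have := div_le_self hy0 hN1
      linarith
    have hδinv : (1 : ℝ) ≤ 1 / δ := by rw [le_div_iff₀ hδ]; linarith
    calc Real.exp ((S ⬝ᵥ (A⁻¹ *ᵥ S)) / σ ^ 2) ≤ (1 / δ) ^ 2 * A.det / lam ^ N := h1
      _ ≤ (1 / δ) ^ 2 * (lam ^ N * (1 + y / N) ^ N) / lam ^ N := by gcongr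
      _ = (1 / δ) ^ 2 * (1 + y / N) ^ N := by field_simp
      -- Here `δ ≤ 1` and `2 ≤ N` let the square of `1 / δ` be absorbed into its `N`th power.
      _ ≤ (1 / δ) ^ N * (1 + y) ^ N := by
          gcongr
      _ = ((1 + y) / δ) ^ N := by rw [← mul_pow]; congr 1; ring
  have hlog : (S ⬝ᵥ (A⁻¹ *ᵥ S)) / σ ^ 2 ≤ N * Real.log ((1 + y) / δ) := by
    rw [← Real.log_pow]
    exact (Real.le_log_iff_exp_le (by positivity)).2 hsq
  rw [div_le_iff₀ (by positivity)] at hlog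
  rw [weightedNorm]
  calc √(S ⬝ᵥ (A⁻¹ *ᵥ S)) ≤ √(σ ^ 2 * (N * Real.log ((1 + y) / δ))) :=
        Real.sqrt_le_sqrt (hlog.trans_eq (mul_comm _ _))
    _ = σ * √(N * Real.log ((1 + y) / δ)) := by
        rw [Real.sqrt_mul (sq_nonneg σ), Real.sqrt_sq hσ.le]

/-- The sum of bounded per-round regrets, split into the rounds with `w t ≤ 1` and the others. -/
theorem sum_le_of_prod_one_add_le {T : ℕ} {r w : ℕ → ℝ} {c b k Q : ℝ} (hb : 0 ≤ b)
    (hk : 0 ≤ k) (hw : ∀ t < T, 0 ≤ w t) (hrc : ∀ t < T, r t ≤ c)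
    (hrw : ∀ t < T, r t ≤ b * √(k * w t)) (hQ : ∏ t ∈ Finset.range T, (1 + w t) ≤ Q) :
    ∑ t ∈ Finset.range T, r t ≤ b * √(2 * T * k * Real.log Q)
      + c * ((Finset.range T).filter fun t => 1 < w t).card := by
  classical
  set B := (Finset.range T).filter fun t => 1 < w t with hB
  set H := (Finset.range T).filter fun t => ¬ 1 < w t with hH
  have hHm {t : ℕ} (ht : t ∈ H) : t < T ∧ w t ≤ 1 := by
    simpa [hH, not_lt] using ht
  have hlog : ∑ t ∈ H, w t ≤ 2 * Real.log Q := by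
    have h1 : ∑ t ∈ Finset.range T, Real.log (1 + w t) ≤ Real.log Q := by
      have hpos (t : ℕ) (ht : t ∈ Finset.range T) : 0 < 1 + w t := by
        have := hw t (Finset.mem_range.1 ht); linarith
      rw [← Real.log_prod fun t ht => (hpos t ht).ne']
      exact Real.log_le_log (Finset.prod_pos hpos) hQ
    have h2 : ∑ t ∈ H, w t ≤ ∑ t ∈ H, 2 * Real.log (1 + w t) := by
      refine Finset.sum_le_sum fun t ht => ?_
      obtain ⟨htT, ht1⟩ := hHm ht
      have h0 := hw t htT
      have h3 := Real.one_sub_inv_le_log_of_pos (x := 1 + w t) (by linarith)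
      -- The right side is `w / (1 + w)`, and `w ≤ 1` bounds the denominator by `2`.
      have h4 : w t / 2 ≤ 1 - (1 + w t)⁻¹ := by
        have h5 : 1 - (1 + w t)⁻¹ = w t / (1 + w t) := by field_simp; ring
        rw [h5]
        exact div_le_div_of_nonneg_left h0 (by linarith) (by linarith)
      linarith
    have h3 : ∑ t ∈ H, Real.log (1 + w t) ≤ ∑ t ∈ Finset.range T, Real.log (1 + w t) := by
      refine Finset.sum_le_sum_of_subset_of_nonneg (Finset.filter_subset _ _) fun t ht _ => ?_
      exact Real.log_nonneg (by have := hw t (Finset.mem_range.1 ht); linarith)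
    rw [← Finset.mul_sum] at h2
    linarith
  have hgood : ∑ t ∈ H, r t ≤ b * √(2 * T * k * Real.log Q) := by
    have h1 : ∑ t ∈ H, r t ≤ b * ∑ t ∈ H, √(k * w t) := by
      rw [Finset.mul_sum]
      exact Finset.sum_le_sum fun t ht => hrw t (hHm ht).1
    refine h1.trans (mul_le_mul_of_nonneg_left (Real.le_sqrt_of_sq_le ?_) hb)
    have h2 := sq_sum_le_card_mul_sum_sq (s := H) (f := fun t => √(k * w t))
    have h3 : ∑ t ∈ H, √(k * w t) ^ 2 = k * ∑ t ∈ H, w t := by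
      rw [Finset.mul_sum]
      exact Finset.sum_congr rfl fun t ht => Real.sq_sqrt (mul_nonneg hk (hw t (hHm ht).1))
    rw [h3] at h2
    have h4 : (H.card : ℝ) ≤ T := by
      exact_mod_cast (Finset.card_filter_le _ _).trans_eq (Finset.card_range T)
    have h5 : 0 ≤ ∑ t ∈ H, w t := Finset.sum_nonneg fun t ht => hw t (hHm ht).1
    calc _ ≤ (H.card : ℝ) * (k * ∑ t ∈ H, w t) := h2
      _ ≤ T * (k * (2 * Real.log Q)) := by gcongr
      _ = _ := by ring
  have hbad : ∑ t ∈ B, r t ≤ c * B.card := by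
    have := Finset.sum_le_card_nsmul B r c fun t ht =>
      hrc t (Finset.mem_range.1 (Finset.mem_filter.1 ht).1)
    rwa [nsmul_eq_mul, mul_comm] at this
  rw [← Finset.sum_filter_add_sum_filter_not (Finset.range T) fun t => 1 < w t]
  linarith

/-- The number of rounds with `w t > 1`. -/
theorem card_filter_one_lt_le_ceil {T n : ℕ} (hn : 2 ≤ n) {w : ℕ → ℝ} {k δ : ℝ} (hδ : 0 < δ)
    (hδ1 : δ ≤ 1) (hw : ∀ t < T, 0 ≤ w t) (hwk : ∀ t < T, w t ≤ k)
    (hprod : ∏ t ∈ Finset.range T, (1 + w t) ≤ (1 + T * k / n) ^ n) :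
    ((Finset.range T).filter fun t => 1 < w t).card ≤ ⌈(n : ℝ) * Real.logb 2 (T * k / δ)⌉₊ := by
  classical
  set B := (Finset.range T).filter fun t => 1 < w t with hB
  rcases B.eq_empty_or_nonempty with h0 | ⟨t₀, ht₀⟩
  · simp [h0]
  have ht₀' := Finset.mem_filter.1 ht₀
  have htT := Finset.mem_range.1 ht₀'.1
  have hk : 1 < k := ht₀'.2.trans_le (hwk t₀ htT)
  have hT : (0 : ℝ) < T := by exact_mod_cast (by omega : 0 < T)
  have hBT : (B.card : ℝ) ≤ T := by
    exact_mod_cast (Finset.card_filter_le _ _).trans_eq (Finset.card_range T)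
  have hx : (T : ℝ) < T * k := by nlinarith
  have hT1 : (1 : ℝ) ≤ T := by exact_mod_cast (by omega : 1 ≤ T)
  have hxδ : T * k ≤ T * k / δ := by rw [le_div_iff₀ hδ]; nlinarith
  have hn0 : (2 : ℝ) ≤ n := by exact_mod_cast hn
  -- A single large round only requires the ceiling to be positive. Two of them force `2 ≤ T`, hence
  -- `2 ≤ T * k`, which is what `1 + T * k / n ≤ T * k` needs.
  rcases Nat.lt_or_ge B.card 2 with h2 | h2
  · have hpos : 0 < (n : ℝ) * Real.logb 2 (T * k / δ) :=
      mul_pos (by linarith) (Real.logb_pos (by norm_num) (by linarith))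
    exact (Nat.le_of_lt_succ h2).trans (Nat.one_le_iff_ne_zero.2 (Nat.ceil_pos.2 hpos).ne')
  · have h2' : (2 : ℝ) ≤ B.card := by exact_mod_cast h2
    have hx2 : 2 ≤ T * k := by linarith
    have hpow : (2 : ℝ) ^ B.card ≤ (T * k / δ) ^ n := by
      calc (2 : ℝ) ^ B.card = ∏ t ∈ B, 2 := by rw [Finset.prod_const]
        _ ≤ ∏ t ∈ B, (1 + w t) := by
            refine Finset.prod_le_prod (fun _ _ => by norm_num) fun t ht => ?_
            have := (Finset.mem_filter.1 ht).2
            linarith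
        _ ≤ ∏ t ∈ Finset.range T, (1 + w t) := by
            refine Finset.prod_le_prod_of_subset_of_one_le (Finset.filter_subset _ _)
              (fun t ht => ?_) fun t ht _ => ?_
            · have := (Finset.mem_filter.1 ht).2
              linarith
            · have := hw t (Finset.mem_range.1 ht)
              linarith
        _ ≤ (1 + T * k / n) ^ n := hprod
        _ ≤ (T * k / δ) ^ n := by
            refine pow_le_pow_left₀ (by positivity) ?_ n
            have : T * k / n ≤ T * k / 2 := div_le_div_of_nonneg_left (by linarith) (by norm_num) hn0
            linarith
    have hlog : (B.card : ℝ) ≤ n * Real.logb 2 (T * k / δ) := by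
      rw [← Real.logb_pow, Real.le_logb_iff_rpow_le (by norm_num) (by positivity),
        Real.rpow_natCast]
      exact hpow
    exact_mod_cast hlog.trans (Nat.le_ceil _)

end EllipticalPotential

/-! ### Counting edges of a cut and the greedy algorithm -/

section Cuts

variable {V : Type*} [Fintype V] {G : SimpleGraph V} [DecidableRel G.Adj]

theorem swap_mem_edges {e : V × V} : e.swap ∈ edges G ↔ e ∈ edges G := by
  simp [edges, G.adj_comm]

variable [DecidableEq V]

theorem edgesFromTo_comm (U W : Finset V) : edgesFromTo G U W = edgesFromTo G W U := by
  refine Finset.card_bij (fun e _ => e.swap) ?_ (fun _ _ _ _ h => Prod.swap_injective h) ?_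
  · intro e he
    rw [Finset.mem_filter] at he ⊢
    exact ⟨swap_mem_edges.2 he.1, he.2.2, he.2.1⟩
  · intro e he
    rw [Finset.mem_filter] at he
    exact ⟨e.swap, Finset.mem_filter.2 ⟨swap_mem_edges.2 he.1, he.2.2, he.2.1⟩, e.swap_swap⟩

theorem edgesFromTo_eq_sum (U W : Finset V) :
    edgesFromTo G U W = ∑ i ∈ U, (W.filter fun j => G.Adj i j).card := by
  rw [edgesFromTo]
  have h : (edges G).filter (fun e => e.1 ∈ U ∧ e.2 ∈ W)
      = (U ×ˢ W).filter fun e => G.Adj e.1 e.2 := by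
    ext e; simp [edges, and_comm]
  rw [h, Finset.card_filter, Finset.sum_product]
  exact Finset.sum_congr rfl fun i _ => (Finset.card_filter _ _).symm

theorem edgesFromTo_insert_left {i : V} {U : Finset V} (hi : i ∉ U) (W : Finset V) :
    edgesFromTo G (insert i U) W = (W.filter fun j => G.Adj i j).card + edgesFromTo G U W := by
  rw [edgesFromTo_eq_sum, edgesFromTo_eq_sum, Finset.sum_insert hi]

theorem edgesFromTo_insert_right {i : V} {W : Finset V} (hi : i ∉ W) (U : Finset V) :
    edgesFromTo G U (insert i W) = (U.filter fun j => G.Adj i j).card + edgesFromTo G U W := by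
  rw [edgesFromTo_comm, edgesFromTo_insert_left hi, edgesFromTo_comm W U]

theorem edgesFromTo_insert_self {i : V} {U : Finset V} (hi : i ∉ U) :
    edgesFromTo G (insert i U) (insert i U)
      = 2 * (U.filter fun j => G.Adj i j).card + edgesFromTo G U U := by
  rw [edgesFromTo_insert_left hi, edgesFromTo_insert_right hi, Finset.filter_insert,
    if_neg (G.irrefl)]
  ring

/-- The invariant is that inner edges never outnumber cut edges. A new node adds twice its
neighbours on its own side to the former and twice those on the other side to the latter, and the
greedy rule makes the second number at least the first. The starting pair is arbitrary for the
induction on the list. -/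
theorem edgesFromTo_foldl_approxMaxCutStep_le (l : List V) (hl : l.Nodup)
    (c : Finset V × Finset V) (h1 : ∀ i ∈ l, i ∉ c.1) (h2 : ∀ i ∈ l, i ∉ c.2)
    (hc : edgesFromTo G c.1 c.1 + edgesFromTo G c.2 c.2
      ≤ edgesFromTo G c.1 c.2 + edgesFromTo G c.2 c.1) :
    edgesFromTo G (l.foldl (approxMaxCutStep G) c).1 (l.foldl (approxMaxCutStep G) c).1
      + edgesFromTo G (l.foldl (approxMaxCutStep G) c).2 (l.foldl (approxMaxCutStep G) c).2
      ≤ edgesFromTo G (l.foldl (approxMaxCutStep G) c).1 (l.foldl (approxMaxCutStep G) c).2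
        + edgesFromTo G (l.foldl (approxMaxCutStep G) c).2
          (l.foldl (approxMaxCutStep G) c).1 := by
  induction l generalizing c with
  | nil => exact hc
  | cons i l ih =>
    rw [List.nodup_cons] at hl
    have hi1 := h1 i List.mem_cons_self
    have hi2 := h2 i List.mem_cons_self
    have hne (j : V) (hj : j ∈ l) : j ≠ i := fun h => hl.1 (h ▸ hj)
    rw [List.foldl_cons]
    refine ih hl.2 _ ?_ ?_ ?_ <;> unfold approxMaxCutStep <;> split_ifs with h
    · exact fun j hj => h1 j (List.mem_cons_of_mem _ hj)
    · exact fun j hj => by simp [hne j hj, h1 j (List.mem_cons_of_mem _ hj)]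
    · exact fun j hj => by simp [hne j hj, h2 j (List.mem_cons_of_mem _ hj)]
    · exact fun j hj => h2 j (List.mem_cons_of_mem _ hj)
    · dsimp only
      rw [edgesFromTo_insert_self hi2, edgesFromTo_insert_left hi2, edgesFromTo_insert_right hi2]
      omega
    · dsimp only
      rw [edgesFromTo_insert_self hi1, edgesFromTo_insert_left hi1, edgesFromTo_insert_right hi1]
      omega

variable {V₁ V₂ : Finset V}

theorem mem_snd_iff_notMem_fst (hdisj : Disjoint V₁ V₂) (hunion : V₁ ∪ V₂ = Finset.univ) (i : V) :
    i ∈ V₂ ↔ i ∉ V₁ := by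
  have h : i ∈ V₁ ∪ V₂ := hunion ▸ Finset.mem_univ i
  rw [Finset.mem_union] at h
  exact ⟨fun h2 h1 => Finset.disjoint_left.1 hdisj h1 h2, fun h1 => h.resolve_left h1⟩

/-- A sum over the edges of a quantity that depends only on the sides of the end points. -/
theorem sum_edges_ite {E : Type*} [AddCommMonoid E] [Module ℝ E] (hdisj : Disjoint V₁ V₂)
    (hunion : V₁ ∪ V₂ = Finset.univ) {α : Type*} (f : α → α → E) (x x' : α) :
    ∑ e ∈ edges G, f (if e.1 ∈ V₁ then x else x') (if e.2 ∈ V₁ then x else x')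
      = (edgesFromTo G V₁ V₂ : ℝ) • f x x' + (edgesFromTo G V₂ V₁ : ℝ) • f x' x
        + (edgesFromTo G V₁ V₁ : ℝ) • f x x + (edgesFromTo G V₂ V₂ : ℝ) • f x' x' := by
  have hm := mem_snd_iff_notMem_fst hdisj hunion
  have hs (U W : Finset V) (y : E) : (edgesFromTo G U W : ℝ) • y
      = ∑ e ∈ edges G, if e.1 ∈ U ∧ e.2 ∈ W then y else 0 := by
    rw [← Finset.sum_filter, Finset.sum_const, Nat.cast_smul_eq_nsmul]; rfl
  rw [hs, hs, hs, hs, ← Finset.sum_add_distrib, ← Finset.sum_add_distrib, ← Finset.sum_add_distrib]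
  refine Finset.sum_congr rfl fun e _ => ?_
  by_cases h1 : e.1 ∈ V₁ <;> by_cases h2 : e.2 ∈ V₁ <;> simp [hm, h1, h2]

theorem card_edges_eq (hdisj : Disjoint V₁ V₂) (hunion : V₁ ∪ V₂ = Finset.univ) :
    ((edges G).card : ℝ) = edgesFromTo G V₁ V₂ + edgesFromTo G V₂ V₁ + edgesFromTo G V₁ V₁
      + edgesFromTo G V₂ V₂ := by
  have h := sum_edges_ite (G := G) hdisj hunion (fun _ _ : Unit => (1 : ℝ)) () ()
  simpa using h

theorem card_edges_le_of_approxMaxCut_eq (hdisj : Disjoint V₁ V₂)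
    (hunion : V₁ ∪ V₂ = Finset.univ) {l : List V} (hl : l.Nodup)
    (h : approxMaxCut G l = (V₁, V₂)) :
    (edges G).card ≤ 2 * (edgesFromTo G V₁ V₂ + edgesFromTo G V₂ V₁) := by
  have h1 := edgesFromTo_foldl_approxMaxCutStep_le (G := G) l hl (∅, ∅) (by simp) (by simp)
    (by simp [edgesFromTo])
  rw [approxMaxCut] at h
  rw [h] at h1
  have h2 := card_edges_eq (G := G) hdisj hunion
  have h3 : (edges G).card = edgesFromTo G V₁ V₂ + edgesFromTo G V₂ V₁ + edgesFromTo G V₁ V₁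
      + edgesFromTo G V₂ V₂ := by exact_mod_cast h2
  simp only at h1
  omega

theorem edgesFromTo_self_eq_zero_of_isBipartiteWith
    (h : G.IsBipartiteWith (V₁ : Set V) (V₂ : Set V)) :
    edgesFromTo G V₁ V₁ = 0 ∧ edgesFromTo G V₂ V₂ = 0 := by
  have hd := Finset.disjoint_coe.1 h.disjoint
  constructor <;> rw [edgesFromTo, Finset.card_eq_zero, Finset.filter_eq_empty_iff] <;>
    rintro e he ⟨h1, h2⟩ <;> rw [edges, Finset.mem_filter] at he <;>
    rcases h.mem_of_adj he.2 with ⟨h3, h4⟩ | ⟨h3, h4⟩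
  · exact Finset.disjoint_left.1 hd h2 h4
  · exact Finset.disjoint_left.1 hd h1 h3
  · exact Finset.disjoint_left.1 hd h3 h1
  · exact Finset.disjoint_left.1 hd h4 h2

end Cuts

/-! ### Rewards of joint arms -/

section Rewards

variable {V : Type*} [Fintype V] {G : SimpleGraph V} [DecidableRel G.Adj] {d : ℕ}

/-- Reversal permutes the directed edges, so twice the reward is a sum over edges of the rewards in
both orientations. -/
theorem two_mul_globalReward_le {M : Matrix (Fin d) (Fin d) ℝ} {X : Finset (Fin d → ℝ)}
    {b : ℝ} (hb : ∀ x ∈ X, ∀ x' ∈ X, edgeReward M x x' + edgeReward M x' x ≤ b)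
    {x : V → Fin d → ℝ} (hx : ∀ i, x i ∈ X) :
    2 * globalReward G M x ≤ (edges G).card * b := by
  have h : globalReward G M x = ∑ e ∈ edges G, edgeReward M (x e.2) (x e.1) := by
    rw [globalReward]
    exact Finset.sum_bij (fun e _ => e.swap) (fun e he => swap_mem_edges.2 he)
      (fun _ _ _ _ h => Prod.swap_injective h)
      (fun e he => ⟨e.swap, swap_mem_edges.2 he, e.swap_swap⟩) fun e _ => rfl
  rw [two_mul]
  nth_rewrite 2 [h]
  rw [globalReward, ← Finset.sum_add_distrib, ← nsmul_eq_mul]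
  exact Finset.sum_le_card_nsmul _ _ _ fun e _ => hb _ (hx _) _ (hx _)

variable [DecidableEq V] {V₁ V₂ : Finset V}

theorem sum_edgeArm_allocate (hdisj : Disjoint V₁ V₂) (hunion : V₁ ∪ V₂ = Finset.univ)
    (x x' : Fin d → ℝ) :
    ∑ e ∈ edges G, edgeArm (allocate V₁ x x' e.1) (allocate V₁ x x' e.2)
      = cutArm G V₁ V₂ x x' :=
  sum_edges_ite hdisj hunion edgeArm x x'

theorem globalReward_allocate (hdisj : Disjoint V₁ V₂) (hunion : V₁ ∪ V₂ = Finset.univ)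
    (M : Matrix (Fin d) (Fin d) ℝ) (x x' : Fin d → ℝ) :
    globalReward G M (allocate V₁ x x') = cutArm G V₁ V₂ x x' ⬝ᵥ vec M := by
  rw [← sum_edgeArm_allocate hdisj hunion, sum_dotProduct, globalReward]
  exact Finset.sum_congr rfl fun e _ => (edgeArm_dotProduct_vec M _ _).symm

theorem cutArm_dotProduct_vec (M : Matrix (Fin d) (Fin d) ℝ) (x x' : Fin d → ℝ) :
    cutArm G V₁ V₂ x x' ⬝ᵥ vec M
      = (edgesFromTo G V₁ V₂ : ℝ) * (edgeReward M x x' + edgeReward M x' x)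
        + edgesFromTo G V₁ V₁ * edgeReward M x x + edgesFromTo G V₂ V₂ * edgeReward M x' x' := by
  rw [cutArm, edgesFromTo_comm V₂ V₁]
  simp only [add_dotProduct, smul_dotProduct, edgeArm_dotProduct_vec, smul_eq_mul]
  ring

theorem edgeReward_le {M : Matrix (Fin d) (Fin d) ℝ} {L S : ℝ} {x x' : Fin d → ℝ}
    (hL : ‖WithLp.toLp 2 (edgeArm x x')‖ ≤ L) (hS : ‖WithLp.toLp 2 (vec M)‖ ≤ S) :
    edgeReward M x x' ≤ L * S := by
  have h := real_inner_le_norm (WithLp.toLp 2 (vec M)) (WithLp.toLp 2 (edgeArm x x'))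
  rw [EuclideanSpace.inner_toLp_toLp, star_trivial, edgeArm_dotProduct_vec, mul_comm] at h
  exact h.trans (mul_le_mul hL hS (norm_nonneg _) ((norm_nonneg _).trans hL))

theorem dotProduct_self_le_sq {ι : Type*} [Fintype ι] {v : ι → ℝ} {L : ℝ}
    (hv : ‖WithLp.toLp 2 v‖ ≤ L) : v ⬝ᵥ v ≤ L ^ 2 := by
  have h : v ⬝ᵥ v = ‖WithLp.toLp 2 v‖ ^ 2 := by
    rw [EuclideanSpace.real_norm_sq_eq]
    simp [dotProduct, sq]
  rw [h]
  exact pow_le_pow_left₀ (norm_nonneg _) hv 2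

end Rewards

/-! ### The confidence event and the regret against the best cut allocation -/

section Regret

theorem measurable_edgeArm_apply {V : Type*} {d : ℕ} (e : V × V) :
    Measurable fun b : V → Fin d → ℝ => edgeArm (b e.1) (b e.2) := by
  unfold edgeArm vec vecMulVec
  refine measurable_pi_lambda _ fun i => ?_
  simp only [of_apply]
  fun_prop

variable {V : Type*} [Fintype V] {G : SimpleGraph V} [DecidableRel G.Adj] {d : ℕ}

theorem weightedNorm_vec_sub_estimator_le {lam S : ℝ} (hlam : 0 < lam)
    {M : Matrix (Fin d) (Fin d) ℝ} (hS : ‖WithLp.toLp 2 (vec M)‖ ≤ S) {Ω : Type*}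
    (η : ℕ → V × V → Ω → ℝ) (a : ℕ → V → Fin d → ℝ) (ω : Ω) (t : ℕ) :
    weightedNorm (designMatrix G lam a t)
        (vec M - estimator G lam a (observedReward M η a ω) t)
      ≤ weightedNorm (designMatrix G lam a t)⁻¹
          (weightedSum G (fun (b : V → Fin d → ℝ) e => edgeArm (b e.1) (b e.2)) a
            (fun s e => η s e ω) t) + √lam * S := by
  have h := weightedNorm_estimator_sub_le (G := G) hlam
    (fun (b : V → Fin d → ℝ) e => edgeArm (b e.1) (b e.2)) a t (fun s e => η s e ω) (vec M)
  simp only [edgeArm_dotProduct_vec] at h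
  refine h.trans (add_le_add le_rfl (mul_le_mul_of_nonneg_left ?_ (Real.sqrt_nonneg _)))
  exact Real.sqrt_le_iff.2 ⟨(norm_nonneg _).trans hS, dotProduct_self_le_sq hS⟩

theorem IsSubGaussianNoise.exists_confidence_event {Ω : Type*} {mΩ : MeasurableSpace Ω}
    {μ : Measure Ω} [IsProbabilityMeasure μ] {ℱ : Filtration ℕ mΩ} {σ : ℝ}
    {η : ℕ → V × V → Ω → ℝ} (hη : IsSubGaussianNoise G μ ℱ σ η) (hσ : 0 ≤ σ) (hd : 2 ≤ d)
    {M : Matrix (Fin d) (Fin d) ℝ} {lam L S δ : ℝ} (hlam : 0 < lam) (hδ : 0 < δ) (hδ1 : δ ≤ 1)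
    (hS : ‖WithLp.toLp 2 (vec M)‖ ≤ S) {T : ℕ} {a : ℕ → Ω → V → Fin d → ℝ}
    (ha : ∀ t < T, Measurable[ℱ t] (a t)) {P : Finset (V → Fin d → ℝ)}
    (hP : ∀ t < T, ∀ ω, a t ω ∈ P)
    (hL : ∀ b ∈ P, ∀ i j, ‖WithLp.toLp 2 (edgeArm (b i) (b j))‖ ≤ L) :
    ∃ D : Set Ω, μ D ≤ ENNReal.ofReal δ ∧ ∀ ω ∉ D, ∀ t ≤ T,
      vec M ∈ confidenceSet G σ lam L S δ (fun s => a s ω)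
        (observedReward M η (fun s => a s ω) ω) t := by
  have : Nonempty (Fin d) := ⟨⟨0, by omega⟩⟩
  have hcard : (Fintype.card (Fin d × Fin d) : ℝ) = (d : ℝ) ^ 2 := by simp [sq]
  have hcard2 : 2 ≤ Fintype.card (Fin d × Fin d) := by
    rw [Fintype.card_prod, Fintype.card_fin]; nlinarith
  set z : (V → Fin d → ℝ) → V × V → Fin d × Fin d → ℝ := fun b e => edgeArm (b e.1) (b e.2)
  have hz (ω : Ω) (t : ℕ) (ht : t ≤ T) :
      ∀ s < t, ∀ e ∈ edges G, z (a s ω) e ⬝ᵥ z (a s ω) e ≤ L ^ 2 := fun s hs e _ =>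
    dotProduct_self_le_sq (hL _ (hP s (hs.trans_le ht) ω) _ _)
  -- The mixture rescales by `σ⁻¹`, so `σ = 0` is treated apart: the noise then vanishes off a null
  -- set and only the regularisation bias remains.
  rcases hσ.eq_or_lt with rfl | hσ
  · refine ⟨{ω | ∃ s, ∃ e ∈ edges G, η s e ω ≠ 0}, ?_, fun ω hω t ht => ?_⟩
    · have h0 : μ {ω | ∃ s, ∃ e ∈ edges G, η s e ω ≠ 0} = 0 := by
        have h : ∀ᵐ ω ∂μ, ∀ s, ∀ e ∈ edges G, η s e ω = 0 :=
          ae_all_iff.2 fun s => (Filter.eventually_all_finset _).2 fun e he => hη.ae_eq_zero s he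
        rw [ae_iff] at h
        simpa using h
      rw [h0]
      exact zero_le
    · refine (weightedNorm_vec_sub_estimator_le hlam hS η _ ω t).trans ?_
      have hsum : weightedSum G z (fun s => a s ω) (fun s e => η s e ω) t = 0 := by
        refine Finset.sum_eq_zero fun s _ => Finset.sum_eq_zero fun e he => ?_
        have : η s e ω = 0 := by
          by_contra hne
          exact hω ⟨s, e, he, hne⟩
        simp only [this, zero_smul]
      rw [hsum, confidenceRadius]
      simp [weightedNorm]
  · refine ⟨_, hη.measure_exists_le_mixture hσ hlam hδ (z := z) measurable_edgeArm_apply ha hP,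
      fun ω hω t ht => ?_⟩
    refine (weightedNorm_vec_sub_estimator_le hlam hS η _ ω t).trans ?_
    have hexp := not_le.1 fun h => hω ⟨t, ht, h⟩
    have h := weightedNorm_weightedSum_le hcard2 hσ hlam hδ hδ1 (hz ω t ht) hexp.le
    rw [hcard] at h
    exact add_le_add h le_rfl

variable [DecidableEq V]

/-- The deterministic part, for one outcome on the good event. The benchmark `c` may be any number
below the value of a cut allocation; it is later `α * OPT`. -/
theorem sum_regret_le_regretBound {V₁ V₂ : Finset V} (hdisj : Disjoint V₁ V₂)
    (hunion : V₁ ∪ V₂ = Finset.univ) (hd : 2 ≤ d) {X : Finset (Fin d → ℝ)}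
    {M : Matrix (Fin d) (Fin d) ℝ} {σ lam L S δ : ℝ} (hσ : 0 ≤ σ) (hlam : 0 < lam) (hδ : 0 < δ)
    (hδ1 : δ ≤ 1) (hL0 : 0 ≤ L) (hS0 : 0 ≤ S)
    (hL : ∀ x ∈ X, ∀ x' ∈ X, ‖WithLp.toLp 2 (edgeArm x x')‖ ≤ L)
    (hpos : ∀ x ∈ X, ∀ x' ∈ X, 0 ≤ edgeReward M x x')
    {xt xt' : Fin d → ℝ} (hxt : xt ∈ X) (hxt' : xt' ∈ X) {c : ℝ}
    (hc : c ≤ cutArm G V₁ V₂ xt xt' ⬝ᵥ vec M) (hcL : c ≤ L * S * (edges G).card)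
    {T : ℕ} {x x' : ℕ → Fin d → ℝ} (hx : ∀ t < T, x t ∈ X) (hx' : ∀ t < T, x' t ∈ X)
    {y : ℕ → V × V → ℝ}
    (hM : ∀ t < T, vec M ∈ confidenceSet G σ lam L S δ (fun s => allocate V₁ (x s) (x' s)) y t)
    (hopt : ∀ t < T,
      ∃ θ ∈ confidenceSet G σ lam L S δ (fun s => allocate V₁ (x s) (x' s)) y t,
        ∀ u ∈ X, ∀ u' ∈ X,
          ∀ θ' ∈ confidenceSet G σ lam L S δ (fun s => allocate V₁ (x s) (x' s)) y t,
            cutArm G V₁ V₂ u u' ⬝ᵥ θ' ≤ cutArm G V₁ V₂ (x t) (x' t) ⬝ᵥ θ) :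
    ∑ t ∈ Finset.range T, (c - globalReward G M (allocate V₁ (x t) (x' t)))
      ≤ regretBound d (edges G).card T σ lam L S δ := by
  have : Nonempty (Fin d) := ⟨⟨0, by omega⟩⟩
  set m := (edges G).card with hm
  set a : ℕ → V → Fin d → ℝ := fun s => allocate V₁ (x s) (x' s) with ha
  set z : (V → Fin d → ℝ) → V × V → Fin d × Fin d → ℝ := fun b e => edgeArm (b e.1) (b e.2)
    with hzdef
  have hcard : (Fintype.card (Fin d × Fin d) : ℝ) = (d : ℝ) ^ 2 := by simp [sq]
  have hcardn : Fintype.card (Fin d × Fin d) = d ^ 2 := by simp [sq]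
  have haX (t : ℕ) (ht : t < T) (i : V) : a t i ∈ X := by
    simp only [ha, allocate]; split_ifs
    · exact hx t ht
    · exact hx' t ht
  have hz (t : ℕ) (ht : t < T) (e : V × V) : z (a t) e ⬝ᵥ z (a t) e ≤ L ^ 2 :=
    dotProduct_self_le_sq (hL _ (haX t ht _) _ (haX t ht _))
  set A : ℕ → Matrix (Fin d × Fin d) (Fin d × Fin d) ℝ := fun t => gramMatrix G lam z a t with hA
  have hAp (t : ℕ) : (A t).PosDef := posDef_gramMatrix hlam z a t
  set w : ℕ → ℝ := fun t => ∑ e ∈ edges G, z (a t) e ⬝ᵥ ((A t)⁻¹ *ᵥ z (a t) e) with hw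
  have hq0 (t : ℕ) (e : V × V) : 0 ≤ z (a t) e ⬝ᵥ ((A t)⁻¹ *ᵥ z (a t) e) := by
    simpa using (hAp t).inv.posSemidef.dotProduct_mulVec_nonneg (z (a t) e)
  have hw0 (t : ℕ) : 0 ≤ w t := Finset.sum_nonneg fun e _ => hq0 t e
  have hwk (t : ℕ) (ht : t < T) : w t ≤ m * L ^ 2 / lam := by
    have h1 : w t ≤ ∑ e ∈ edges G, L ^ 2 / lam := by
      refine Finset.sum_le_sum fun e _ => ?_
      rw [le_div_iff₀ hlam, mul_comm]
      exact (dotProduct_inv_gramMatrix_le hlam z a t _).trans (hz t ht e)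
    rw [Finset.sum_const, nsmul_eq_mul] at h1
    exact h1.trans_eq (by ring)
  have hprod : ∏ t ∈ Finset.range T, (1 + w t)
      ≤ (1 + T * m * L ^ 2 / lam / (d : ℝ) ^ 2) ^ (d ^ 2) := by
    have h1 := (prod_one_add_le_det_gramMatrix (G := G) hlam z a T).trans
      (det_gramMatrix_le hlam fun s hs e _ => hz s hs e)
    have h2 := le_of_mul_le_mul_left h1 (pow_pos hlam _)
    rwa [hcard, hcardn] at h2
  set R := confidenceRadius d m σ lam L S δ T with hR
  have hRmono (t : ℕ) (ht : t < T) : confidenceRadius d m σ lam L S δ t ≤ R := by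
    have : (t : ℝ) ≤ T := by exact_mod_cast ht.le
    rw [hR, confidenceRadius, confidenceRadius]
    gcongr
  have hR0 : 0 ≤ R := by rw [hR, confidenceRadius]; positivity
  have hsum0 (t : ℕ) (ht : t < T) : 0 ≤ globalReward G M (a t) :=
    Finset.sum_nonneg fun e _ => hpos _ (haX t ht _) _ (haX t ht _)
  -- By optimism the optimistic value of the played pair is at least `c`. Both `θ` and `vec M` lie
  -- within `R` of the estimator, hence within `2 * R` of each other. Cauchy–Schwarz is used twice,
  -- on each edge-arm and then over the `m` edges.
  have hround (t : ℕ) (ht : t < T) : c - globalReward G M (a t) ≤ 2 * R * √(m * w t) := by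
    obtain ⟨θ, hθ, hmax⟩ := hopt t ht
    have h1 := hmax xt hxt xt' hxt' (vec M) (hM t ht)
    have hdiff : weightedNorm (A t) (θ - vec M) ≤ 2 * R := by
      have h2 : θ - vec M = (θ - estimator G lam a y t) + -(vec M - estimator G lam a y t) := by
        abel
      have h3 : weightedNorm (A t) (θ - estimator G lam a y t) ≤ R := le_trans hθ (hRmono t ht)
      have h4 : weightedNorm (A t) (vec M - estimator G lam a y t) ≤ R :=
        le_trans (hM t ht) (hRmono t ht)
      have h5 : weightedNorm (A t) (-(vec M - estimator G lam a y t)) ≤ R := by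
        refine le_trans (le_of_eq ?_) h4
        simp only [weightedNorm, mulVec_neg, neg_dotProduct_neg]
      rw [h2]
      refine (weightedNorm_add_le (hAp t) _ _).trans ?_
      linarith
    have h2 : c - globalReward G M (a t) ≤ cutArm G V₁ V₂ (x t) (x' t) ⬝ᵥ (θ - vec M) := by
      rw [dotProduct_sub, ha, globalReward_allocate hdisj hunion]
      linarith
    have h3 : cutArm G V₁ V₂ (x t) (x' t) ⬝ᵥ (θ - vec M)
        ≤ ∑ e ∈ edges G, 2 * R * weightedNorm (A t)⁻¹ (z (a t) e) := by
      rw [← sum_edgeArm_allocate hdisj hunion, sum_dotProduct]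
      refine Finset.sum_le_sum fun e _ => ?_
      refine (le_abs_self _).trans ((abs_dotProduct_le_weightedNorm_mul (hAp t) _ _).trans ?_)
      rw [mul_comm]
      exact mul_le_mul_of_nonneg_right hdiff (Real.sqrt_nonneg _)
    refine h2.trans (h3.trans ?_)
    rw [← Finset.mul_sum]
    refine mul_le_mul_of_nonneg_left (Real.le_sqrt_of_sq_le ?_) (by linarith)
    refine sq_sum_le_card_mul_sum_sq.trans_eq ?_
    congr 1
    exact Finset.sum_congr rfl fun e _ => Real.sq_sqrt (hq0 t e)
  have hcard_le : ((Finset.range T).filter fun t => 1 < w t).card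
      ≤ ⌈(d : ℝ) ^ 2 * Real.logb 2 (T * m * L ^ 2 / lam / δ)⌉₊ := by
    have h := card_filter_one_lt_le_ceil (T := T) (n := d ^ 2) (w := w) (k := m * L ^ 2 / lam)
      (by nlinarith) hδ hδ1 (fun t _ => hw0 t) hwk (hprod.trans_eq (by push_cast; ring))
    have hk : (T : ℝ) * (m * L ^ 2 / lam) = T * m * L ^ 2 / lam := by ring
    rwa [hk, Nat.cast_pow] at h
  -- Rewards are nonnegative, so no round costs more than `c ≤ L * S * m`; this is the charge for
  -- rounds with `w t > 1`.
  have hfinal := sum_le_of_prod_one_add_le (T := T)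
    (r := fun t => c - globalReward G M (a t)) (w := w) (c := L * S * m) (b := 2 * R)
    (k := m) (by linarith) (Nat.cast_nonneg _) (fun t _ => hw0 t)
    (fun t ht => by linarith [hsum0 t ht]) hround hprod
  refine hfinal.trans ?_
  rw [regretBound]
  refine add_le_add ?_ ?_
  · have hlog : 0 ≤ Real.log (1 + T * m * L ^ 2 / lam / (d : ℝ) ^ 2) :=
      Real.log_nonneg (le_add_of_nonneg_right (by positivity))
    rw [mul_comm 2 R, mul_assoc, mul_comm R]
    refine mul_le_mul_of_nonneg_right ?_ hR0
    refine Real.le_sqrt_of_sq_le ?_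
    rw [Real.log_pow, mul_pow, Real.sq_sqrt (by positivity)]
    push_cast
    -- The square to be bounded has constant `4 * 2 = 8`, while `32 * max 2 _` is at least `64`.
    have hmax : (2 : ℝ) ≤ max 2 ((L * S) ^ 2) := le_max_left _ _
    have hnn : 0 ≤ (T : ℝ) * m * (d : ℝ) ^ 2
        * Real.log (1 + T * m * L ^ 2 / lam / (d : ℝ) ^ 2) := by positivity
    nlinarith [mul_le_mul_of_nonneg_left hmax hnn]
  · exact mul_le_mul_of_nonneg_left (by exact_mod_cast hcard_le) (by positivity)

end Regret

end GraphicalBilinear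

/-! ### The comparison with the optimum and the main theorem -/

open GraphicalBilinear in
theorem theorem4p1
    {V : Type*} [Fintype V] [DecidableEq V] (G : SimpleGraph V) [DecidableRel G.Adj]
    {Ω : Type*} {mΩ : MeasurableSpace Ω} (μ : Measure Ω) [IsProbabilityMeasure μ]
    (ℱ : Filtration ℕ mΩ)
    {d : ℕ} (hd : 2 ≤ d)
    (X : Finset (Fin d → ℝ)) (M : Matrix (Fin d) (Fin d) ℝ)
    (σ lam L S δ : ℝ) (hσ : 0 ≤ σ) (hlam : 0 < lam) (hδ : 0 < δ) (hδ1 : δ ≤ 1)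
    -- the Euclidean norms of the edge-arms are at most `L`, the Frobenius norm of `M` at most `S`
    (hL : ∀ x ∈ X, ∀ x' ∈ X, ‖WithLp.toLp 2 (edgeArm x x')‖ ≤ L)
    (hS : ‖WithLp.toLp 2 (vec M)‖ ≤ S)
    (hpos : ∀ x ∈ X, ∀ x' ∈ X, 0 ≤ edgeReward M x x')
    (η : ℕ → V × V → Ω → ℝ) (hη : IsSubGaussianNoise G μ ℱ σ η)
    -- the cut
    (V₁ V₂ : Finset V) (hdisj : Disjoint V₁ V₂) (hunion : V₁ ∪ V₂ = Finset.univ)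
    -- the optimal joint arm
    (xopt : V → Fin d → ℝ) (hxopt : ∀ i, xopt i ∈ X)
    (hopt : ∀ x : V → Fin d → ℝ, (∀ i, x i ∈ X) → globalReward G M x ≤ globalReward G M xopt)
    (hopt_pos : 0 < globalReward G M xopt)
    -- the pair that is best along one edge
    (xs xs' : Fin d → ℝ) (hxs : xs ∈ X) (hxs' : xs' ∈ X)
    (hs : ∀ x ∈ X, ∀ x' ∈ X,
      (edgeArm x x' + edgeArm x' x) ⬝ᵥ vec M ≤ (edgeArm xs xs' + edgeArm xs' xs) ⬝ᵥ vec M)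
    -- the pair that is best for the cut
    (xt xt' : Fin d → ℝ) (hxt : xt ∈ X) (hxt' : xt' ∈ X)
    (ht : ∀ x ∈ X, ∀ x' ∈ X,
      cutArm G V₁ V₂ x x' ⬝ᵥ vec M ≤ cutArm G V₁ V₂ xt xt' ⬝ᵥ vec M)
    (γ Δ ε α : ℝ)
    (hγ : IsLeast ((fun x => edgeArm x x ⬝ᵥ vec M /
      (1 / ((edges G).card : ℝ) * globalReward G M xopt)) '' (X : Set (Fin d → ℝ))) γ)
    (hΔ : Δ = (cutArm G V₁ V₂ xt xt' - cutArm G V₁ V₂ xs xs') ⬝ᵥ vec M)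
    (hε : ε = Δ / globalReward G M xopt)
    (hα : α = 1 - (((edgesFromTo G V₁ V₁ : ℝ) + edgesFromTo G V₂ V₂) / ((edges G).card : ℝ)
      * (1 - γ) - ε))
    -- a run of the algorithm
    (T : ℕ) (x x' : ℕ → Ω → Fin d → ℝ)
    (hrun : IsImprovedOFULRun G ℱ X M η V₁ V₂ σ lam L S δ T x x') :
    -- the ranges of the parameters
    (0 ≤ γ ∧ γ ≤ 1 ∧ 0 ≤ Δ ∧ 0 ≤ ε ∧ α ≤ 1) ∧
    -- the greedy algorithm cuts at least half of the edges
    (∀ l : List V, l.Nodup → (∀ i, i ∈ l) → approxMaxCut G l = (V₁, V₂) →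
      (edges G).card ≤ 2 * (edgesFromTo G V₁ V₂ + edgesFromTo G V₂ V₁)) ∧
    -- the ranges of `ε` and `α` for a cut through at least half of the edges
    ((edges G).card ≤ 2 * (edgesFromTo G V₁ V₂ + edgesFromTo G V₂ V₁) → ε ≤ 1 / 2 ∧ 1 / 2 ≤ α) ∧
    -- bipartite graphs
    (G.IsBipartiteWith (V₁ : Set V) (V₂ : Set V) → ε = 0 ∧ α = 1) ∧
    -- the `α`-regret
    1 - δ ≤ μ.real {ω | alphaRegret G M α xopt (fun t => allocate V₁ (x t ω) (x' t ω)) T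
      ≤ regretBound d (edges G).card T σ lam L S δ} := by
  classical
  have hm0 : (0 : ℝ) < (edges G).card := by
    rcases (edges G).eq_empty_or_nonempty with h | h
    · simp [globalReward, h] at hopt_pos
    · exact_mod_cast h.card_pos
  set m := (((edges G).card : ℕ) : ℝ) with hm
  set OPT := globalReward G M xopt with hOPT
  have hcard := card_edges_eq (G := G) hdisj hunion
  rw [edgesFromTo_comm V₂ V₁, ← hm] at hcard
  have hsplit (y y' : Fin d → ℝ) := globalReward_allocate (G := G) hdisj hunion M y y'
  have hL0 : 0 ≤ L := (norm_nonneg _).trans (hL xs hxs xs hxs)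
  have hS0 : 0 ≤ S := (norm_nonneg _).trans hS
  simp only [edgeArm_dotProduct_vec] at hγ
  obtain ⟨⟨x₀, hx₀, hγ₀⟩, hγle⟩ := hγ
  have hγx (y : Fin d → ℝ) (hy : y ∈ X) : γ * OPT / m ≤ edgeReward M y y := by
    have h := hγle ⟨y, hy, rfl⟩
    simp only at h
    rw [le_div_iff₀ (by positivity)] at h
    exact (le_of_eq (by ring)).trans h
  have hγ0 : 0 ≤ γ := by
    rw [← hγ₀]
    exact div_nonneg (hpos _ hx₀ _ hx₀) (by positivity)
  have hγ1 : γ ≤ 1 := by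
    have h1 := hopt (fun _ => x₀) fun _ => hx₀
    have h2 : globalReward G M (fun _ => x₀) = m * edgeReward M x₀ x₀ := by
      simp [globalReward, hm]
    have h3 := hγx x₀ hx₀
    rw [div_le_iff₀ hm0] at h3
    nlinarith
  have hΔ0 : 0 ≤ Δ := by
    rw [hΔ, sub_dotProduct]
    linarith [ht xs hxs xs' hxs']
  have hε0 : 0 ≤ ε := hε ▸ div_nonneg hΔ0 hopt_pos.le
  set m₁ := ((edgesFromTo G V₁ V₁ : ℕ) : ℝ) with hm₁
  set m₂ := ((edgesFromTo G V₂ V₂ : ℕ) : ℝ) with hm₂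
  set m₁₂ := ((edgesFromTo G V₁ V₂ : ℕ) : ℝ) with hm₁₂
  have hm₁0 : 0 ≤ m₁ := Nat.cast_nonneg _
  have hm₂0 : 0 ≤ m₂ := Nat.cast_nonneg _
  have hm₁₂0 : 0 ≤ m₁₂ := Nat.cast_nonneg _
  -- The `m₁₂` edge pairs across the cut earn at least `2 * OPT / m` each, and each of the `m₁ + m₂`
  -- inner edges at least `γ * OPT / m`; then `m = 2 * m₁₂ + m₁ + m₂`.
  have hbase : OPT * (1 - (m₁ + m₂) / m * (1 - γ)) ≤ cutArm G V₁ V₂ xs xs' ⬝ᵥ vec M := by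
    have hpair : 2 * OPT ≤ m * (edgeReward M xs xs' + edgeReward M xs' xs) :=
      two_mul_globalReward_le (fun y hy y' hy' => by
        simpa only [add_dotProduct, edgeArm_dotProduct_vec] using hs y hy y' hy') hxopt
    have h1 : 2 * OPT / m ≤ edgeReward M xs xs' + edgeReward M xs' xs := by
      rw [div_le_iff₀ hm0]; linarith
    rw [cutArm_dotProduct_vec]
    have h2 := mul_le_mul_of_nonneg_left h1 hm₁₂0
    have h3 := mul_le_mul_of_nonneg_left (hγx xs hxs) hm₁0
    have h4 := mul_le_mul_of_nonneg_left (hγx xs' hxs') hm₂0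
    have h5 : OPT * (1 - (m₁ + m₂) / m * (1 - γ))
        = m₁₂ * (2 * OPT / m) + m₁ * (γ * OPT / m) + m₂ * (γ * OPT / m) := by
      field_simp
      rw [hcard]
      ring
    linarith
  have hεOPT : ε * OPT = Δ := by rw [hε, div_mul_cancel₀ _ hopt_pos.ne']
  have hcut : cutArm G V₁ V₂ xt xt' ⬝ᵥ vec M ≤ OPT := by
    rw [← hsplit]
    refine hopt _ fun i => ?_
    unfold allocate
    split_ifs
    · exact hxt
    · exact hxt'
  rw [sub_dotProduct] at hΔ
  -- The gain `Δ` is at most `OPT` minus the lower bound for the pair `(xs, xs')`. This one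
  -- inequality yields `α ≤ 1`, the bound `ε ≤ 1 / 2` for large cuts, and `ε = 0` in the bipartite
  -- case.
  have hεle : ε ≤ (m₁ + m₂) / m * (1 - γ) := by
    refine le_of_mul_le_mul_right ?_ hopt_pos
    rw [hεOPT]
    linarith
  have hαOPT : α * OPT ≤ cutArm G V₁ V₂ xt xt' ⬝ᵥ vec M := by
    have : α * OPT = OPT * (1 - (m₁ + m₂) / m * (1 - γ)) + ε * OPT := by rw [hα]; ring
    rw [this, hεOPT]
    linarith
  refine ⟨⟨hγ0, hγ1, hΔ0, hε0, by linarith⟩, fun l hl _ h =>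
    card_edges_le_of_approxMaxCut_eq hdisj hunion hl h, fun h => ?_, fun h => ?_, ?_⟩
  · have h' : m ≤ 2 * (m₁₂ + m₁₂) := by
      rw [edgesFromTo_comm V₂ V₁] at h
      rw [hm, hm₁₂]
      exact_mod_cast h
    have h1 : (m₁ + m₂) / m ≤ 1 / 2 := by
      rw [div_le_iff₀ hm0]; linarith
    have h2 : 0 ≤ (m₁ + m₂) / m := by positivity
    have h3 : (m₁ + m₂) / m * (1 - γ) ≤ 1 / 2 := by nlinarith
    exact ⟨by linarith, by linarith⟩
  · obtain ⟨h1, h2⟩ := edgesFromTo_self_eq_zero_of_isBipartiteWith h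
    have h3 : (m₁ + m₂) / m * (1 - γ) = 0 := by simp [hm₁, hm₂, h1, h2]
    have h4 : ε = 0 := le_antisymm (hεle.trans_eq h3) hε0
    exact ⟨h4, by rw [hα, h3, h4]; ring⟩
  · set a : ℕ → Ω → V → Fin d → ℝ := fun t ω => allocate V₁ (x t ω) (x' t ω) with ha
    have hameas (t : ℕ) (htT : t < T) : Measurable[ℱ t] (a t) := by
      refine @measurable_pi_lambda _ _ _ (ℱ t) _ _ fun i => ?_
      simp only [ha, allocate]
      split_ifs
      · exact hrun.measurable_fst t htT
      · exact hrun.measurable_snd t htT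
    set P : Finset (V → Fin d → ℝ) := (X ×ˢ X).image fun y => allocate V₁ y.1 y.2 with hPdef
    have hP (t : ℕ) (htT : t < T) (ω : Ω) : a t ω ∈ P :=
      Finset.mem_image.2 ⟨(x t ω, x' t ω),
        Finset.mem_product.2 ⟨hrun.mem_fst t htT ω, hrun.mem_snd t htT ω⟩, rfl⟩
    have hPX (b : V → Fin d → ℝ) (hb : b ∈ P) (i : V) : b i ∈ X := by
      obtain ⟨y, hy, rfl⟩ := Finset.mem_image.1 hb
      rw [Finset.mem_product] at hy
      unfold allocate
      split_ifs
      · exact hy.1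
      · exact hy.2
    obtain ⟨D, hD, hconf⟩ := hη.exists_confidence_event hσ hd (M := M) hlam hδ hδ1 hS hameas hP
      fun b hb i j => hL _ (hPX b hb i) _ (hPX b hb j)
    have hOPTle : OPT ≤ L * S * m := by
      have h1 := Finset.sum_le_card_nsmul (edges G)
        (fun e => edgeReward M (xopt e.1) (xopt e.2)) (L * S) fun e _ =>
          edgeReward_le (hL _ (hxopt _) _ (hxopt _)) hS
      rw [nsmul_eq_mul, mul_comm] at h1
      exact h1
    have hsub : Dᶜ ⊆ {ω | alphaRegret G M α xopt (fun t => allocate V₁ (x t ω) (x' t ω)) T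
        ≤ regretBound d (edges G).card T σ lam L S δ} := by
      intro ω hω
      exact sum_regret_le_regretBound hdisj hunion hd hσ hlam hδ hδ1 hL0 hS0 hL hpos hxt hxt'
        hαOPT ((hαOPT.trans hcut).trans hOPTle) (fun t htT => hrun.mem_fst t htT ω)
        (fun t htT => hrun.mem_snd t htT ω) (fun t htT => hconf ω hω t htT.le)
        fun t htT => hrun.optimistic t htT ω
    refine le_trans ?_ (measureReal_mono hsub)
    -- Subadditivity suffices, so `D` need not be measurable.
    have h1 : μ.real Set.univ ≤ μ.real D + μ.real Dᶜ := by
      rw [← Set.union_compl_self D]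
      exact measureReal_union_le _ _
    rw [probReal_univ] at h1
    have h2 : μ.real D ≤ δ := ENNReal.toReal_le_of_le_ofReal hδ.le hD
    linarith
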